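/- Let $\otimes$ be a continuous t-norm on $[0,1]$, i.e. an associative, commutative, continuous operation on $[0,1]$ with neutral element $1$ that preserves suprema in each variable, and let $\hom(u,-)$ be the right adjoint of $u\otimes-$. Write $u\ominus v=\max(u-v,0)$ and $u\oplus v=\min(u+v,1)$. **Algebraic side.** A $[0,1]$-category is a set $X$ with a map $a:X\times X\to[0,1]$ such that $a(x,x)=1$ and $a(x,y)\otimes a(y,z)\le a(x,z)$; it is ordered by $x\le y\iff a(x,y)=1$, and it is separated if this order is antisymmetric. $\mathsf{FinSup}_{[0,1]}$ is the category of separated $[0,1]$-categories having all weighted colimits of diagrams with finite underlying set, and of $[0,1]$-functors preserving them. An object of both $\mathsf{Mnd}_\ominus(\mathsf{FinSup}_{[0,1]})$ and $\mathsf{LaxMnd}_\ominus(\mathsf{FinSup}_{[0,1]})$ is an object $A$ of $\mathsf{FinSup}_{[0,1]}$ with a commutative monoid structure whose unit is the top element and for which every $x\otimes-:A\to A$ is a morphism of $\mathsf{FinSup}_{[0,1]}$, together with an action $\ominus:A\times[0,1]\to A$ of the monoid $([0,1],\oplus,0)$, i.e. $x\ominus 0=x$ and $(x\ominus u)\ominus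 v=x\ominus(u\oplus v)$. A morphism of $\mathsf{LaxMnd}_\ominus(\mathsf{FinSup}_{[0,1]})$ is a morphism $f$ of $\mathsf{FinSup}_{[0,1]}$ with $f(x\otimes y)\le f(x)\otimes f(y)$ and $f(x\ominus u)=f(x)\ominus u$; a morphism of $\mathsf{Mnd}_\ominus(\mathsf{FinSup}_{[0,1]})$ preserves multiplication, unit and $\ominus$ strictly. The interval $[0,1]$ with $\hom$, $\otimes$ and $\ominus$ is an object of both categories. **Topological side.** $\mathsf{PosComp}$ is the category of partially ordered compact spaces (compact spaces with a partial order whose graph is closed) and continuous monotone maps. The Vietoris monad $\mathbb V$ on $\mathsf{PosComp}$ sends $X$ to the set $VX$ of closed upper subsets of $X$, ordered by $\supseteq$, with the topology generated by the sets $\{A\mid A\cap U\ne\varnothing\}$ ($U$ open lower) and $\{A\mid A\cap K=\varnothing\}$ ($K$ closed lower); $Vf(A)$ is the upper closure of $f[A]$, the unit is $x\mapsto{\uparrow}x$ and the multiplication is union. $\mathsf{PosCompDist}$ is the Kleisli category of $\mathbb V$; its morphisms $\varphi:X\to VY$ are regarded as relations, $x\,\varphi\,y\iff y\in\varphi(x)$.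 **Theorem.** 1. The dualising object $([0,1]^{\mathrm{op}},[0,1])$ induces a dual adjunction $C\dashv G$ between $C:\mathsf{PosComp}\to\mathsf{LaxMnd}_\ominus(\mathsf{FinSup}_{[0,1]})^{\mathrm{op}}$ and $G$. Here $CX=\mathsf{PosComp}(X,[0,1]^{\mathrm{op}})$ with all operations defined pointwise (so $[\psi,\psi']=\inf_{x}\hom(\psi(x),\psi'(x))$), and $GA=\mathsf{LaxMnd}_\ominus(\mathsf{FinSup}_{[0,1]})(A,[0,1])$ with the initial order and the initial topology with respect to all evaluation maps $\mathrm{ev}_a:GA\to[0,1]^{\mathrm{op}}$, $\Phi\mapsto\Phi(a)$; $C$ and $G$ act on morphisms by precomposition, and both units of the adjunction are given by evaluation, $x\mapsto\mathrm{ev}_x$ and $a\mapsto\mathrm{ev}_a$. 2. Putting $C\varphi(\psi)(x)=\sup_{x\,\varphi\,y}\psi(y)$ for $\varphi:X\to Y$ in $\mathsf{PosCompDist}$ and $\psi\in CY$ extends $C$ along the canonical functor $\mathsf{PosComp}\to\mathsf{PosCompDist}$ to a functor $C:\mathsf{PosCompDist}\to\mathsf{LaxMnd}_\ominus(\mathsf{FinSup}_{[0,1]})^{\mathrm{op}}$.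 The monad morphism $j$ from $\mathbb V$ to the monad induced by $C\dashv G$ that corresponds to this extension is given by $j_X(A)(\psi)=\sup_{x\in A}\psi(x)$, and $j$ is an isomorphism. 3. The functors $C:\mathsf{PosCompDist}\to\mathsf{LaxMnd}_\ominus(\mathsf{FinSup}_{[0,1]})^{\mathrm{op}}$ and $C:\mathsf{PosComp}\to\mathsf{Mnd}_\ominus(\mathsf{FinSup}_{[0,1]})^{\mathrm{op}}$ are fully faithful. -/

import Mathlib

open CategoryTheory Opposite unitInterval

universe u v w

noncomputable section

namespace EnrichedDuality

/-! ### Continuous t-norms on the unit interval -/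

/-- Truncated minus on `[0,1]`. -/
def tminus (u v : I) : I :=
  ⟨max ((u : ℝ) - v) 0, le_max_right _ _, max_le (by linarith [u.2.2, v.2.1]) zero_le_one⟩

/-- Truncated plus on `[0,1]`. -/
def tplus (u v : I) : I :=
  ⟨min ((u : ℝ) + v) 1, le_min (add_nonneg u.2.1 v.2.1) zero_le_one, min_le_right _ _⟩

/-- A continuous t-norm: a commutative quantale structure on the complete lattice `[0,1]` with
neutral element `1`, continuous for the Euclidean topology. -/
structure ContTNorm where
  tensor : I → I → I
  assoc : ∀ u v w, tensor (tensor u v) w = tensor u (tensor v w)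
  comm : ∀ u v, tensor u v = tensor v u
  tensor_one : ∀ u, tensor u 1 = u
  tensor_sSup : ∀ (u : I) (S : Set I), tensor u (sSup S) = sSup (tensor u '' S)
  continuous_tensor : Continuous fun p : I × I => tensor p.1 p.2

namespace ContTNorm

variable (T : ContTNorm)

/-- The internal hom: `T.hom u` is right adjoint to `T.tensor u`. -/
def hom (u w : I) : I := sSup {v | T.tensor u v ≤ w}

theorem one_tensor (u : I) : T.tensor 1 u = u := by rw [T.comm, T.tensor_one]

theorem tensor_iSup {ι : Sort*} (u : I) (f : ι → I) :
    T.tensor u (⨆ i, f i) = ⨆ i, T.tensor u (f i) := by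
  rw [iSup, T.tensor_sSup, ← Set.range_comp]; rfl

theorem iSup_tensor {ι : Sort*} (u : I) (f : ι → I) :
    T.tensor (⨆ i, f i) u = ⨆ i, T.tensor (f i) u := by
  rw [T.comm, T.tensor_iSup]; simp only [T.comm]

theorem tensor_mono_right (u : I) {v w : I} (h : v ≤ w) : T.tensor u v ≤ T.tensor u w := by
  have h1 := T.tensor_sSup u {v, w}
  rw [Set.image_pair, sSup_pair, sSup_pair, sup_eq_right.2 h] at h1
  rw [h1]; exact le_sup_left

theorem tensor_mono {u u' v v' : I} (h : u ≤ u') (h' : v ≤ v') :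
    T.tensor u v ≤ T.tensor u' v' := by
  refine (T.tensor_mono_right u h').trans ?_
  rw [T.comm u, T.comm u']; exact T.tensor_mono_right v' h

theorem le_hom_iff (u v w : I) : v ≤ T.hom u w ↔ T.tensor u v ≤ w := by
  constructor
  · intro h
    refine (T.tensor_mono_right u h).trans ?_
    rw [hom, T.tensor_sSup]
    refine sSup_le ?_
    rintro _ ⟨v, hv, rfl⟩
    exact hv
  · intro h; exact le_sSup h

theorem one_le_hom_iff (u w : I) : 1 ≤ T.hom u w ↔ u ≤ w := by
  rw [le_hom_iff, tensor_one]

theorem hom_comp (u v w : I) : T.tensor (T.hom u v) (T.hom v w) ≤ T.hom u w := by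
  rw [le_hom_iff, ← T.assoc]
  refine (T.tensor_mono ((T.le_hom_iff u _ v).1 le_rfl) le_rfl).trans ?_
  exact (T.le_hom_iff v _ w).1 le_rfl

theorem hom_iSup_tensor {ι : Sort*} (f g : ι → I) (w : I) :
    T.hom (⨆ i, T.tensor (f i) (g i)) w = ⨅ i, T.hom (g i) (T.hom (f i) w) := by
  refine eq_of_forall_le_iff fun c => ?_
  simp only [le_iInf_iff, le_hom_iff, iSup_tensor, iSup_le_iff, T.assoc]

end ContTNorm

/-! ### Categories enriched in `[0,1]` -/

/-- A `[0,1]`-category. -/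
structure VCat (T : ContTNorm) : Type (u + 1) where
  carrier : Type u
  hom : carrier → carrier → I
  hom_refl : ∀ x, 1 ≤ hom x x
  hom_trans : ∀ x y z, T.tensor (hom x y) (hom y z) ≤ hom x z

namespace VCat

variable {T : ContTNorm}

/-- The natural order of a `[0,1]`-category. -/
def le (X : VCat.{u} T) (x y : X.carrier) : Prop := 1 ≤ X.hom x y

/-- A `[0,1]`-category is separated when its natural order is antisymmetric. -/
def Separated (X : VCat.{u} T) : Prop := ∀ x y, X.le x y → X.le y x → x = y

/-- `[0,1]`-functors. -/
def IsFunctor (X : VCat.{u} T) (Y : VCat.{v} T) (f : X.carrier → Y.carrier) : Prop :=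
  ∀ x y, X.hom x y ≤ Y.hom (f x) (f y)

/-- `[0,1]`-distributors from `A` to the one-point `[0,1]`-category. -/
def IsWeight (A : VCat.{u} T) (ψ : A.carrier → I) : Prop :=
  ∀ z z', T.tensor (A.hom z z') (ψ z') ≤ ψ z

/-- `x₀` is a colimit of the diagram `h` weighted by `ψ`. -/
def IsColimit (X : VCat.{u} T) {S : Type w} (h : S → X.carrier) (ψ : S → I)
    (x₀ : X.carrier) : Prop :=
  ∀ x, X.hom x₀ x = ⨅ z, T.hom (ψ z) (X.hom (h z) x)

/-- Every weighted colimit diagram of finite shape has a colimit. -/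
def FinCocomplete (X : VCat.{u} T) : Prop :=
  ∀ (A : VCat.{0} T) (h : A.carrier → X.carrier) (ψ : A.carrier → I), Finite A.carrier →
    A.IsFunctor X h → A.IsWeight ψ → ∃ x₀, X.IsColimit h ψ x₀

/-- `[0,1]`-functors that preserve all colimits of weighted diagrams of finite shape. -/
def FinCocontinuous (X : VCat.{u} T) (Y : VCat.{v} T) (f : X.carrier → Y.carrier) : Prop :=
  X.IsFunctor Y f ∧
    ∀ (A : VCat.{0} T) (h : A.carrier → X.carrier) (ψ : A.carrier → I), Finite A.carrier →
      A.IsFunctor X h → A.IsWeight ψ →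
        ∀ x₀, X.IsColimit h ψ x₀ → Y.IsColimit (f ∘ h) ψ (f x₀)

theorem IsFunctor.comp {X : VCat.{u} T} {Y : VCat.{v} T} {Z : VCat.{w} T}
    {f : X.carrier → Y.carrier} {g : Y.carrier → Z.carrier}
    (hg : Y.IsFunctor Z g) (hf : X.IsFunctor Y f) : X.IsFunctor Z (g ∘ f) :=
  fun x y => (hf x y).trans (hg _ _)

theorem FinCocontinuous.id (X : VCat.{u} T) : X.FinCocontinuous X (fun x => x) :=
  ⟨fun _ _ => le_rfl, fun _ _ _ _ _ _ _ h => h⟩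

theorem FinCocontinuous.comp {X : VCat.{u} T} {Y : VCat.{v} T} {Z : VCat.{w} T}
    {f : X.carrier → Y.carrier} {g : Y.carrier → Z.carrier}
    (hg : Y.FinCocontinuous Z g) (hf : X.FinCocontinuous Y f) :
    X.FinCocontinuous Z (fun x => g (f x)) :=
  ⟨hg.1.comp hf.1, fun A h ψ hA hh hψ x₀ hx =>
    hg.2 A (f ∘ h) ψ hA (hf.1.comp hh) hψ _ (hf.2 A h ψ hA hh hψ x₀ hx)⟩

theorem FinCocontinuous.mono {X : VCat.{u} T} {Y : VCat.{v} T} {f : X.carrier → Y.carrier}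
    (hf : X.FinCocontinuous Y f) {x y : X.carrier} (h : X.le x y) : Y.le (f x) (f y) :=
  h.trans (hf.1 x y)

theorem le_trans' {X : VCat.{u} T} {x y z : X.carrier} (h : X.le x y) (h' : X.le y z) :
    X.le x z := by
  have h1 := (T.tensor_mono h h').trans (X.hom_trans x y z)
  rwa [T.tensor_one] at h1

end VCat

/-! ### Commutative monoids in separated finitely cocomplete `[0,1]`-categories -/

/-- The objects of `FinSup`: separated finitely cocomplete `[0,1]`-categories. -/
structure FinSup (T : ContTNorm) : Type (u + 1) extends VCat.{u} T where
  separated : toVCat.Separated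
  finCocomplete : toVCat.FinCocomplete

/-- Commutative monoids in `FinSup` whose unit is the top element; multiplication by a fixed
element is finitely cocontinuous. -/
structure FinSupMonoid (T : ContTNorm) : Type (u + 1) extends FinSup.{u} T where
  mul : carrier → carrier → carrier
  one : carrier
  mul_assoc : ∀ x y z, mul (mul x y) z = mul x (mul y z)
  mul_comm : ∀ x y, mul x y = mul y x
  mul_one : ∀ x, mul x one = x
  le_one : ∀ x, toVCat.le x one
  mul_finCocontinuous : ∀ x, toVCat.FinCocontinuous toVCat (mul x)

/-- A commutative monoid in `FinSup` equipped with an additional action `⊖` of `[0,1]`, that is,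
an action of the monoid `[0,1]` under truncated addition. -/
structure OminusMonoid (T : ContTNorm) : Type (u + 1) extends FinSupMonoid.{u} T where
  minus : carrier → I → carrier
  minus_zero : ∀ x, minus x 0 = x
  minus_minus : ∀ x u v, minus (minus x u) v = minus x (tplus u v)

variable {T : ContTNorm}

/-- Lax monoid homomorphisms: finitely cocontinuous `[0,1]`-functors that laxly preserve the
multiplication and strictly preserve the action `⊖`. -/
@[ext]
structure LaxHom (A : OminusMonoid.{u} T) (B : OminusMonoid.{v} T) : Type (max u v) where
  toFun : A.carrier → B.carrier
  finCocontinuous : A.toVCat.FinCocontinuous B.toVCat toFun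
  map_mul_le : ∀ x y, B.toVCat.le (toFun (A.mul x y)) (B.mul (toFun x) (toFun y))
  map_minus : ∀ x u, toFun (A.minus x u) = B.minus (toFun x) u

/-- Monoid homomorphisms: finitely cocontinuous `[0,1]`-functors that preserve the
multiplication, the unit and the action `⊖`. -/
@[ext]
structure StrictHom (A : OminusMonoid.{u} T) (B : OminusMonoid.{v} T) : Type (max u v) where
  toFun : A.carrier → B.carrier
  finCocontinuous : A.toVCat.FinCocontinuous B.toVCat toFun
  map_mul : ∀ x y, toFun (A.mul x y) = B.mul (toFun x) (toFun y)
  map_one : toFun A.one = B.one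
  map_minus : ∀ x u, toFun (A.minus x u) = B.minus (toFun x) u

/-- Composition of lax monoid homomorphisms. -/
def LaxHom.comp {A : OminusMonoid.{u} T} {B : OminusMonoid.{v} T} {D : OminusMonoid.{w} T}
    (g : LaxHom B D) (f : LaxHom A B) : LaxHom A D where
  toFun x := g.toFun (f.toFun x)
  finCocontinuous := g.finCocontinuous.comp f.finCocontinuous
  map_mul_le x y :=
    VCat.le_trans' (g.finCocontinuous.mono (f.map_mul_le x y)) (g.map_mul_le _ _)
  map_minus x u := by rw [f.map_minus, g.map_minus]

variable (T) in
/-- The category of `⊖`-monoids in `FinSup` and lax monoid homomorphisms. -/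
structure LaxMnd : Type (u + 1) where
  ob : OminusMonoid.{u} T

variable (T) in
/-- The category of `⊖`-monoids in `FinSup` and monoid homomorphisms. -/
structure Mnd : Type (u + 1) where
  ob : OminusMonoid.{u} T

instance : Category.{u} (LaxMnd.{u} T) where
  Hom A B := LaxHom A.ob B.ob
  id A := ⟨fun x => x, VCat.FinCocontinuous.id _, fun _ _ => A.ob.hom_refl _, fun _ _ => rfl⟩
  comp f g := g.comp f

instance : Category.{u} (Mnd.{u} T) where
  Hom A B := StrictHom A.ob B.ob
  id A := ⟨fun x => x, VCat.FinCocontinuous.id _, fun _ _ => rfl, rfl, fun _ _ => rfl⟩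
  comp f g := ⟨fun x => g.toFun (f.toFun x), g.finCocontinuous.comp f.finCocontinuous,
    fun x y => by rw [f.map_mul, g.map_mul], by rw [f.map_one, g.map_one],
    fun x u => by rw [f.map_minus, g.map_minus]⟩

variable (T) in
/-- The faithful functor from strict to lax homomorphisms, the identity on objects. -/
def toLax : Mnd.{u} T ⥤ LaxMnd.{u} T where
  obj A := ⟨A.ob⟩
  map {A B} f := ⟨f.toFun, f.finCocontinuous,
    fun x y => by rw [f.map_mul]; exact B.ob.hom_refl _, f.map_minus⟩
  map_id _ := rfl
  map_comp _ _ := rfl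

/-! ### The unit interval as an object -/

theorem tminus_zero (x : I) : tminus x 0 = x := by
  apply Subtype.ext
  simp [tminus, x.2.1]

theorem tminus_tminus (x u v : I) : tminus (tminus x u) v = tminus x (tplus u v) := by
  apply Subtype.ext
  have := x.2.1; have := x.2.2; have := u.2.1; have := u.2.2; have := v.2.1
  have := v.2.2
  simp only [tminus, tplus]
  grind

theorem tminus_mono {x y : I} (u : I) (h : x ≤ y) : tminus x u ≤ tminus y u :=
  Subtype.coe_le_coe.1 (max_le_max (sub_le_sub_right (Subtype.coe_le_coe.2 h) _) le_rfl)

theorem continuous_tminus (u : I) : Continuous fun x => tminus x u := by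
  unfold tminus; fun_prop

variable (T) in
/-- The `[0,1]`-category `[0,1]`. -/
abbrev unitVCat : VCat.{0} T where
  carrier := I
  hom := T.hom
  hom_refl x := (T.one_le_hom_iff x x).2 le_rfl
  hom_trans := T.hom_comp

theorem unitVCat_isColimit_iff {S : Type w} (h : S → I) (ψ : S → I) (x₀ : I) :
    (unitVCat T).IsColimit h ψ x₀ ↔ x₀ = ⨆ z, T.tensor (h z) (ψ z) := by
  have key : ∀ x, (⨅ z, T.hom (ψ z) (T.hom (h z) x)) = T.hom (⨆ z, T.tensor (h z) (ψ z)) x :=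
    fun x => (T.hom_iSup_tensor h ψ x).symm
  constructor
  · intro hx
    have hx' : ∀ x, T.hom x₀ x = T.hom (⨆ z, T.tensor (h z) (ψ z)) x := fun x =>
      (hx x).trans (key x)
    refine eq_of_forall_ge_iff fun c => ?_
    rw [← T.one_le_hom_iff, hx', T.one_le_hom_iff]
  · rintro rfl x
    exact (key x).symm

variable (T) in
/-- The unit interval with its tensor and truncated minus. -/
abbrev unitOb : OminusMonoid.{0} T where
  toVCat := unitVCat T
  separated x y h h' := le_antisymm (α := I) ((T.one_le_hom_iff x y).1 h) ((T.one_le_hom_iff y x).1 h')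
  finCocomplete _ h ψ _ _ _ := ⟨_, (unitVCat_isColimit_iff h ψ _).2 rfl⟩
  mul := T.tensor
  one := (1 : I)
  mul_assoc := T.assoc
  mul_comm := T.comm
  mul_one := T.tensor_one
  le_one x := (T.one_le_hom_iff x 1).2 x.2.2
  mul_finCocontinuous a := by
    refine ⟨fun x y => ?_, fun A h ψ _ _ _ x₀ hx => ?_⟩
    · refine (T.le_hom_iff _ _ _).2 ?_
      rw [T.assoc]
      exact T.tensor_mono_right a ((T.le_hom_iff x _ y).1 le_rfl)
    · rw [unitVCat_isColimit_iff] at hx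
      refine (unitVCat_isColimit_iff _ ψ _).2 ?_
      rw [hx, T.tensor_iSup]
      simp only [Function.comp, T.assoc]
  minus := tminus
  minus_zero := tminus_zero
  minus_minus := tminus_tminus

/-! ### Partially ordered compact spaces -/

/-- Partially ordered compact spaces: compact spaces with a partial order whose graph is closed
(they are automatically Hausdorff). -/
structure PosComp : Type (u + 1) where
  carrier : Type u
  [top : TopologicalSpace carrier]
  [ord : PartialOrder carrier]
  [compact : CompactSpace carrier]
  [closed : OrderClosedTopology carrier]

namespace PosComp

instance : CoeSort PosComp.{u} (Type u) := ⟨carrier⟩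

instance (X : PosComp.{u}) : TopologicalSpace X := X.top
instance (X : PosComp.{u}) : PartialOrder X := X.ord
instance (X : PosComp.{u}) : CompactSpace X := X.compact
instance (X : PosComp.{u}) : OrderClosedTopology X := X.closed

/-- Morphisms are the continuous monotone maps. -/
instance : Category.{u} PosComp.{u} where
  Hom X Y := X →Co Y
  id X := ContinuousOrderHom.id X
  comp f g := ContinuousOrderHom.comp g f

/-- The continuous monotone map underlying a morphism. -/
def fn {X Y : PosComp.{u}} (f : X ⟶ Y) : X →Co Y := f

end PosComp

/-! ### The Vietoris monad -/

section Vietoris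

set_option linter.unusedSectionVars false

variable (X : Type u) [TopologicalSpace X] [PartialOrder X]

/-- Closed upper subsets. -/
@[ext]
structure ClosedUpper : Type u where
  carrier : Set X
  isClosed : IsClosed carrier
  isUpper : IsUpperSet carrier

variable {X}

/-- The order on closed upper sets is containment `⊇`. -/
instance : PartialOrder (ClosedUpper X) where
  le A B := B.carrier ⊆ A.carrier
  le_refl _ := subset_rfl
  le_trans _ _ _ h h' := h'.trans h
  le_antisymm _ _ h h' := ClosedUpper.ext (h'.antisymm h)

/-- The closed upper sets that meet `U`. -/
def hit (U : Set X) : Set (ClosedUpper X) := {A | (A.carrier ∩ U).Nonempty}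

/-- The closed upper sets disjoint from `K`. -/
def miss (K : Set X) : Set (ClosedUpper X) := {A | A.carrier ∩ K = ∅}

variable (X) in
/-- The subbasis of the Vietoris topology. -/
def vietorisSubbasis : Set (Set (ClosedUpper X)) :=
  {s | (∃ U : Set X, IsOpen U ∧ IsLowerSet U ∧ s = hit U) ∨
    ∃ K : Set X, IsClosed K ∧ IsLowerSet K ∧ s = miss K}

instance : TopologicalSpace (ClosedUpper X) :=
  TopologicalSpace.generateFrom (vietorisSubbasis X)

theorem isOpen_hit {U : Set X} (h : IsOpen U) (h' : IsLowerSet U) : IsOpen (hit U) :=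
  TopologicalSpace.isOpen_generateFrom_of_mem (Or.inl ⟨U, h, h', rfl⟩)

theorem isOpen_miss {K : Set X} (h : IsClosed K) (h' : IsLowerSet K) : IsOpen (miss K) :=
  TopologicalSpace.isOpen_generateFrom_of_mem (Or.inr ⟨K, h, h', rfl⟩)

theorem compl_miss (K : Set X) : (miss K)ᶜ = hit K := by
  ext A; simp [miss, hit, Set.nonempty_iff_ne_empty]

theorem isLowerSet_hit (U : Set X) : IsLowerSet (hit U) := by
  rintro A B hBA ⟨x, hx, hxU⟩
  exact ⟨x, hBA hx, hxU⟩

theorem continuous_to_closedUpper {Y : Type v} [TopologicalSpace Y] {f : Y → ClosedUpper X}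
    (h1 : ∀ U : Set X, IsOpen U → IsLowerSet U → IsOpen (f ⁻¹' hit U))
    (h2 : ∀ K : Set X, IsClosed K → IsLowerSet K → IsClosed (f ⁻¹' hit K)) :
    Continuous f := by
  refine continuous_generateFrom_iff.2 ?_
  rintro s (⟨U, hU, hU', rfl⟩ | ⟨K, hK, hK', rfl⟩)
  · exact h1 U hU hU'
  · have := (h2 K hK hK').isOpen_compl
    rwa [← Set.preimage_compl, ← compl_miss, compl_compl] at this

variable [CompactSpace X] [OrderClosedTopology X]

theorem isClosed_up {A : Set X} (hA : IsClosed A) : IsClosed {y | ∃ x ∈ A, x ≤ y} := by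
  have h : IsClosed {p : X × X | p.1 ∈ A ∧ p.1 ≤ p.2} :=
    (hA.preimage continuous_fst).inter OrderClosedTopology.isClosed_le'
  have h2 := (h.isCompact.image continuous_snd).isClosed
  convert h2 using 1
  ext y; simp

theorem isClosed_down {A : Set X} (hA : IsClosed A) : IsClosed {y | ∃ x ∈ A, y ≤ x} := by
  have h : IsClosed {p : X × X | p.1 ∈ A ∧ p.2 ≤ p.1} :=
    (hA.preimage continuous_fst).inter
      (OrderClosedTopology.isClosed_le'.preimage continuous_swap)
  have h2 := (h.isCompact.image continuous_snd).isClosed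
  convert h2 using 1
  ext y; simp

instance : CompactSpace (ClosedUpper X) := by
  refine ⟨isCompact_generateFrom rfl fun P hP hcov => ?_⟩
  let W : Set X := ⋃ U ∈ {U | IsOpen U ∧ IsLowerSet U ∧ hit U ∈ P}, U
  have hW : IsOpen W := isOpen_biUnion fun U hU => hU.1
  have hW' : IsLowerSet W := isLowerSet_iUnion₂ fun U hU => hU.2.1
  let A : ClosedUpper X := ⟨Wᶜ, hW.isClosed_compl, hW'.compl⟩
  obtain ⟨s, hs, hAs⟩ := hcov (Set.mem_univ A)
  rcases hP hs with ⟨U, hU, hU', rfl⟩ | ⟨K, hK, hK', rfl⟩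
  · obtain ⟨x, hx, hxU⟩ := hAs
    exact absurd (Set.mem_iUnion₂.2 ⟨U, ⟨hU, hU', hs⟩, hxU⟩) hx
  · have hKW : K ⊆ W := by
      intro x hx
      by_contra hxW
      have : x ∈ A.carrier ∩ K := ⟨hxW, hx⟩
      rw [show A.carrier ∩ K = ∅ from hAs] at this
      exact this
    obtain ⟨t, ht, htf, hKt⟩ := IsCompact.elim_finite_subcover_image
      (b := {U | IsOpen U ∧ IsLowerSet U ∧ hit U ∈ P}) (c := id) hK.isCompact
      (fun U hU => hU.1) hKW
    refine ⟨insert (miss K) (hit '' t), ?_, (htf.image _).insert _, ?_⟩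
    · rintro _ (rfl | ⟨U, hU, rfl⟩)
      · exact hs
      · exact (ht hU).2.2
    · intro B _
      by_cases hB : B ∈ miss K
      · exact ⟨_, Set.mem_insert _ _, hB⟩
      · have hB' : B ∈ hit K := by rw [← compl_miss]; exact hB
        obtain ⟨x, hxB, hxK⟩ := hB'
        obtain ⟨U, hU, hxU⟩ := Set.mem_iUnion₂.1 (hKt hxK)
        exact ⟨hit U, Or.inr ⟨U, hU, rfl⟩, x, hxB, hxU⟩

instance : OrderClosedTopology (ClosedUpper X) := by
  refine ⟨isOpen_compl_iff.1 (isOpen_iff_forall_mem_open.2 ?_)⟩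
  rintro ⟨A, B⟩ hAB
  obtain ⟨x, hxB, hxA⟩ := Set.not_subset.1 (show ¬ B.carrier ⊆ A.carrier from hAB)
  have hdisj : Disjoint A.carrier (Set.Iic x) :=
    Set.disjoint_left.2 fun y hy hyx => hxA (A.isUpper hyx hy)
  obtain ⟨O₁, O₂, hO₁, hO₂, hAO, hxO, hO⟩ :=
    SeparatedNhds.of_isCompact_isCompact A.isClosed.isCompact
      (isClosed_Iic (a := x)).isCompact hdisj
  let K : Set X := {y | ∃ z ∈ O₁ᶜ, y ≤ z}
  let U : Set X := {y | ∃ z ∈ O₂ᶜ, z ≤ y}ᶜ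
  have hK : IsClosed K := isClosed_down hO₁.isClosed_compl
  have hK' : IsLowerSet K := fun a b hba ⟨z, hz, haz⟩ => ⟨z, hz, hba.trans haz⟩
  have hU : IsOpen U := (isClosed_up hO₂.isClosed_compl).isOpen_compl
  have hU' : IsLowerSet U := fun a b hba ha ⟨z, hz, hzb⟩ => ha ⟨z, hz, hzb.trans hba⟩
  refine ⟨miss K ×ˢ hit U, ?_, (isOpen_miss hK hK').prod (isOpen_hit hU hU'), ?_, ?_⟩
  · rintro ⟨A', B'⟩ ⟨hA', y, hyB, hyU⟩ hle
    have hyA : y ∈ A'.carrier := (show B'.carrier ⊆ A'.carrier from hle) hyB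
    have hyO₂ : y ∈ O₂ := by
      by_contra hy
      exact hyU ⟨y, hy, le_rfl⟩
    have hyK : y ∈ K := ⟨y, fun hy => Set.disjoint_left.1 hO hy hyO₂, le_rfl⟩
    have : y ∈ A'.carrier ∩ K := ⟨hyA, hyK⟩
    rw [show A'.carrier ∩ K = ∅ from hA'] at this
    exact this
  · refine Set.eq_empty_iff_forall_notMem.2 ?_
    rintro y ⟨hyA, z, hz, hyz⟩
    exact hz (hAO (A.isUpper hyz hyA))
  · exact ⟨x, hxB, fun ⟨z, hz, hzx⟩ => hz (hxO hzx)⟩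

/-- The principal upper set `↑x`. -/
def upc (x : X) : ClosedUpper X := ⟨Set.Ici x, isClosed_Ici, isUpperSet_Ici x⟩

theorem upc_mem_hit {U : Set X} (hU : IsLowerSet U) (x : X) : upc x ∈ hit U ↔ x ∈ U :=
  ⟨fun ⟨_, hy, hyU⟩ => hU hy hyU, fun hx => ⟨x, le_rfl, hx⟩⟩

theorem continuous_upc : Continuous (upc : X → ClosedUpper X) := by
  refine continuous_to_closedUpper (fun U hU hU' => ?_) fun K hK hK' => ?_
  · rwa [show upc ⁻¹' hit U = U from Set.ext fun x => upc_mem_hit hU' x]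
  · rwa [show upc ⁻¹' hit K = K from Set.ext fun x => upc_mem_hit hK' x]

theorem monotone_upc : Monotone (upc : X → ClosedUpper X) :=
  fun _ _ h => Set.Ici_subset_Ici.2 h

theorem mem_sUnion_iff (𝒜 : ClosedUpper (ClosedUpper X)) (x : X) :
    (∃ A ∈ 𝒜.carrier, x ∈ A.carrier) ↔ upc x ∈ 𝒜.carrier :=
  ⟨fun ⟨A, hA, hx⟩ => 𝒜.isUpper (show A ≤ upc x from fun _ hy => A.isUpper hy hx) hA,
    fun h => ⟨upc x, h, le_refl x⟩⟩

/-- The union of a closed upper set of closed upper sets. -/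
def bigUnion (𝒜 : ClosedUpper (ClosedUpper X)) : ClosedUpper X where
  carrier := {x | ∃ A ∈ 𝒜.carrier, x ∈ A.carrier}
  isClosed := by
    simp only [mem_sUnion_iff]
    exact 𝒜.isClosed.preimage continuous_upc
  isUpper := fun _ _ hxy ⟨A, hA, hx⟩ => ⟨A, hA, A.isUpper hxy hx⟩

theorem bigUnion_mem_hit (U : Set X) (𝒜 : ClosedUpper (ClosedUpper X)) :
    bigUnion 𝒜 ∈ hit U ↔ 𝒜 ∈ hit (hit U) :=
  ⟨fun ⟨x, ⟨A, hA, hx⟩, hU⟩ => ⟨A, hA, x, hx, hU⟩, fun ⟨A, hA, x, hx, hU⟩ => ⟨x, ⟨A, hA, hx⟩, hU⟩⟩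

theorem isClosed_hit {K : Set X} (h : IsClosed K) (h' : IsLowerSet K) : IsClosed (hit K) := by
  rw [← compl_miss]
  exact (isOpen_miss h h').isClosed_compl

theorem continuous_bigUnion :
    Continuous (bigUnion : ClosedUpper (ClosedUpper X) → ClosedUpper X) := by
  refine continuous_to_closedUpper (fun U hU hU' => ?_) fun K hK hK' => ?_
  · rw [show bigUnion ⁻¹' hit U = hit (hit U) from Set.ext fun x => bigUnion_mem_hit U x]
    exact isOpen_hit (isOpen_hit hU hU') (isLowerSet_hit U)
  · rw [show bigUnion ⁻¹' hit K = hit (hit K) from Set.ext fun x => bigUnion_mem_hit K x]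
    exact isClosed_hit (isClosed_hit hK hK') (isLowerSet_hit K)

variable {Y : Type v} [TopologicalSpace Y] [PartialOrder Y] [CompactSpace Y]
  [OrderClosedTopology Y]

/-- `A ↦ ↑f[A]`, the smallest closed upper set containing the image. -/
def upImage (f : X →Co Y) (A : ClosedUpper X) : ClosedUpper Y where
  carrier := {y | ∃ x ∈ A.carrier, f x ≤ y}
  isClosed := by
    have := isClosed_up (A.isClosed.isCompact.image f.continuous_toFun).isClosed
    convert this using 1
    ext y
    simp only [Set.mem_ofPred_eq, Set.mem_image, exists_exists_and_eq_and]
    rfl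
  isUpper := fun _ _ h ⟨x, hx, hxy⟩ => ⟨x, hx, hxy.trans h⟩

theorem upImage_mem_hit (f : X →Co Y) {U : Set Y} (hU : IsLowerSet U) (A : ClosedUpper X) :
    upImage f A ∈ hit U ↔ A ∈ hit (f ⁻¹' U) :=
  ⟨fun ⟨_, ⟨x, hx, hxy⟩, hy⟩ => ⟨x, hx, hU hxy hy⟩, fun ⟨x, hx, hU'⟩ => ⟨f x, ⟨x, hx, le_rfl⟩, hU'⟩⟩

theorem continuous_upImage (f : X →Co Y) : Continuous (upImage f) := by
  refine continuous_to_closedUpper (fun U hU hU' => ?_) fun K hK hK' => ?_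
  · rw [show upImage f ⁻¹' hit U = hit (f ⁻¹' U) from Set.ext fun A => upImage_mem_hit f hU' A]
    exact isOpen_hit (hU.preimage f.continuous_toFun) (hU'.preimage f.monotone')
  · rw [show upImage f ⁻¹' hit K = hit (f ⁻¹' K) from Set.ext fun A => upImage_mem_hit f hK' A]
    exact isClosed_hit (hK.preimage f.continuous_toFun) (hK'.preimage f.monotone')

end Vietoris

/-- The Vietoris functor on partially ordered compact spaces. -/
def vietorisFunctor : PosComp.{u} ⥤ PosComp.{u} where
  obj X := { carrier := ClosedUpper X }
  map {X Y} f :=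
    { toFun := upImage (X := X) (Y := Y) f
      monotone' := fun _ _ h _ ⟨x, hx, hxy⟩ => ⟨x, h hx, hxy⟩
      continuous_toFun := continuous_upImage _ }
  map_id X := by
    refine ContinuousOrderHom.ext fun A => ClosedUpper.ext (Set.ext fun y => ?_)
    exact ⟨fun ⟨x, hx, hxy⟩ => A.isUpper hxy hx, fun hy => ⟨y, hy, le_rfl⟩⟩
  map_comp {X Y Z} f g := by
    refine ContinuousOrderHom.ext fun A => ClosedUpper.ext (Set.ext fun z => ?_)
    constructor
    · rintro ⟨x, hx, hxz⟩
      exact ⟨PosComp.fn f x, ⟨x, hx, le_rfl⟩, hxz⟩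
    · rintro ⟨y, ⟨x, hx, hxy⟩, hyz⟩
      exact ⟨x, hx, ((PosComp.fn g).monotone' hxy).trans hyz⟩

/-- The Vietoris monad on partially ordered compact spaces: the unit is `x ↦ ↑x` and the
multiplication is union. -/
def vietoris : Monad PosComp.{u} where
  toFunctor := vietorisFunctor
  η :=
    { app X := { toFun := upc (X := X), monotone' := monotone_upc,
                 continuous_toFun := continuous_upc }
      naturality X Y f := by
        refine ContinuousOrderHom.ext fun x => ClosedUpper.ext (Set.ext fun y => ?_)
        exact ⟨fun h => ⟨x, le_refl x, h⟩,
          fun ⟨x', hx', h⟩ => ((PosComp.fn f).monotone' hx').trans h⟩ }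
  μ :=
    { app X := { toFun := bigUnion (X := X),
                 monotone' := fun _ _ h _ ⟨A, hA, hx⟩ => ⟨A, h hA, hx⟩,
                 continuous_toFun := continuous_bigUnion }
      naturality X Y f := by
        refine ContinuousOrderHom.ext fun 𝒜 => ClosedUpper.ext (Set.ext fun y => ?_)
        constructor
        · rintro ⟨B, ⟨A, hA, hAB⟩, hy⟩
          obtain ⟨x, hx, hxy⟩ := hAB hy
          exact ⟨x, ⟨A, hA, hx⟩, hxy⟩
        · rintro ⟨x, ⟨A, hA, hx⟩, hxy⟩
          exact ⟨upImage f A, ⟨A, hA, le_rfl⟩, x, hx, hxy⟩ }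
  assoc X := by
    refine ContinuousOrderHom.ext fun 𝒜 => ClosedUpper.ext (Set.ext fun x => ?_)
    constructor
    · rintro ⟨A, ⟨ℬ, hℬ, hA⟩, hx⟩
      obtain ⟨B, hB, hxB⟩ := hA hx
      exact ⟨B, ⟨ℬ, hℬ, hB⟩, hxB⟩
    · rintro ⟨A, ⟨ℬ, hℬ, hA⟩, hx⟩
      exact ⟨bigUnion ℬ, ⟨ℬ, hℬ, le_rfl⟩, A, hA, hx⟩
  left_unit X := by
    refine ContinuousOrderHom.ext fun A => ClosedUpper.ext (Set.ext fun x => ?_)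
    exact ⟨fun ⟨B, hB, hx⟩ => hB hx, fun hx => ⟨A, le_refl A, hx⟩⟩
  right_unit X := by
    refine ContinuousOrderHom.ext fun A => ClosedUpper.ext (Set.ext fun x => ?_)
    constructor
    · rintro ⟨B, ⟨y, hy, hyB⟩, hx⟩
      exact A.isUpper (hyB hx) hy
    · intro hx
      exact ⟨upc x, ⟨x, hx, le_rfl⟩, le_refl x⟩

/-- Partially ordered compact spaces and continuous distributors, that is, the Kleisli category
of the Vietoris monad: a morphism `φ : X ⟶ Y` relates `x` to the elements of the closed upper
set `φ x`. -/
abbrev PosCompDist := Kleisli vietoris.{u}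

/-- The relation underlying a continuous distributor. -/
def PosCompDist.Rel {X Y : PosCompDist.{u}} (φ : X ⟶ Y) (x : X.of) (y : Y.of) : Prop :=
  y ∈ (show ClosedUpper Y.of from PosComp.fn φ.of x).carrier

/-- The identity is the order relation. -/
theorem PosCompDist.rel_id (X : PosCompDist.{u}) (x y : X.of) :
    PosCompDist.Rel (𝟙 X) x y ↔ x ≤ y := Iff.rfl

/-- Composition is relational composition. -/
theorem PosCompDist.rel_comp {X Y Z : PosCompDist.{u}} (φ : X ⟶ Y) (γ : Y ⟶ Z)
    (x : X.of) (z : Z.of) :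
    PosCompDist.Rel (φ ≫ γ) x z ↔ ∃ y, PosCompDist.Rel φ x y ∧ PosCompDist.Rel γ y z := by
  constructor
  · rintro ⟨A, ⟨y, hy, hyA⟩, hz⟩
    exact ⟨y, hy, hyA hz⟩
  · rintro ⟨y, hy, hz⟩
    exact ⟨PosComp.fn γ.of y, ⟨y, hy, le_rfl⟩, hz⟩

/-! ### The functor `C` -/

section FunctionSpace

set_option linter.unusedSectionVars false

variable {X : Type u} [TopologicalSpace X] [PartialOrder X]

/-- The value in `[0,1]` of a continuous monotone map into `[0,1]ᵒᵖ`. -/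
def val (ψ : X →Co Iᵒᵈ) (x : X) : I := OrderDual.ofDual (ψ x)

/-- Continuous antitone maps into `[0,1]` as morphisms into `[0,1]ᵒᵖ`. -/
def mkC (f : X → I) (hf : Continuous f) (hf' : Antitone f) : X →Co Iᵒᵈ where
  toFun x := OrderDual.toDual (f x)
  monotone' := hf'
  continuous_toFun := hf

@[simp]
theorem val_mkC (f : X → I) (hf : Continuous f) (hf' : Antitone f) (x : X) :
    val (mkC f hf hf') x = f x := rfl

theorem val_ext {ψ ψ' : X →Co Iᵒᵈ} (h : ∀ x, val ψ x = val ψ' x) : ψ = ψ' :=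
  ContinuousOrderHom.ext h

theorem continuous_val (ψ : X →Co Iᵒᵈ) : Continuous (val ψ) := ψ.continuous_toFun

theorem antitone_val (ψ : X →Co Iᵒᵈ) : Antitone (val ψ) := ψ.monotone'

theorem continuous_iSup_finite {Y : Type u} [TopologicalSpace Y] {S : Type w} [Finite S]
    {f : S → Y → I} (hf : ∀ z, Continuous (f z)) : Continuous fun x => ⨆ z, f z x := by
  have := Fintype.ofFinite S
  simp only [← Finset.sup_univ_eq_iSup]
  exact Continuous.finset_sup_apply fun z _ => hf z

variable (T X) in
/-- The `[0,1]`-category of continuous monotone maps into `[0,1]ᵒᵖ`, with the pointwise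
structure. -/
abbrev funVCat : VCat.{u} T where
  carrier := X →Co Iᵒᵈ
  hom ψ ψ' := ⨅ x, T.hom (val ψ x) (val ψ' x)
  hom_refl _ := le_iInf fun _ => (T.one_le_hom_iff _ _).2 le_rfl
  hom_trans _ _ _ := le_iInf fun x =>
    (T.tensor_mono (iInf_le _ x) (iInf_le _ x)).trans (T.hom_comp _ _ _)

theorem funVCat_le_iff (ψ ψ' : X →Co Iᵒᵈ) :
    (funVCat T X).le ψ ψ' ↔ ∀ x, val ψ x ≤ val ψ' x := by
  simp only [VCat.le, le_iInf_iff, T.one_le_hom_iff]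

theorem funVCat_sep : (funVCat T X).Separated := fun ψ ψ' h h' =>
  val_ext fun x => le_antisymm ((funVCat_le_iff ψ ψ').1 h x) ((funVCat_le_iff ψ' ψ).1 h' x)

theorem tensor_antitone {f g : X → I} (hf : Antitone f) (hg : Antitone g) :
    Antitone fun x => T.tensor (f x) (g x) := fun _ _ h => T.tensor_mono (hf h) (hg h)

theorem tminus_antitone {f : X → I} (u : I) (hf : Antitone f) :
    Antitone fun x => tminus (f x) u := fun _ _ h => tminus_mono u (hf h)

theorem finColim_antitone {S : Type w} (h : S → X →Co Iᵒᵈ) (ψ : S → I) :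
    Antitone fun x => ⨆ z, T.tensor (val (h z) x) (ψ z) :=
  fun _ _ hxy => iSup_mono fun z => T.tensor_mono (antitone_val (h z) hxy) le_rfl

variable (T) in
/-- Finite weighted colimits are computed pointwise. -/
def finColim {S : Type w} [Finite S] (h : S → X →Co Iᵒᵈ) (ψ : S → I) : X →Co Iᵒᵈ :=
  mkC (fun x => ⨆ z, T.tensor (val (h z) x) (ψ z))
    (continuous_iSup_finite fun z =>
      T.continuous_tensor.comp ((continuous_val (h z)).prodMk continuous_const))
    (finColim_antitone h ψ)

theorem funVCat_isColimit_iff {S : Type w} [Finite S] (h : S → X →Co Iᵒᵈ) (ψ : S → I)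
    (x₀ : X →Co Iᵒᵈ) : (funVCat T X).IsColimit h ψ x₀ ↔
      ∀ x, val x₀ x = ⨆ z, T.tensor (val (h z) x) (ψ z) := by
  have hcol : (funVCat T X).IsColimit h ψ (finColim T h ψ) := by
    intro χ
    refine eq_of_forall_le_iff fun c => ?_
    simp only [finColim, val_mkC, T.hom_iSup_tensor, le_iInf_iff, T.le_hom_iff]
    exact forall_comm
  constructor
  · intro hx
    have : x₀ = finColim T h ψ := by
      refine funVCat_sep (T := T) _ _ ?_ ?_
      · have := (funVCat T X).hom_refl (finColim T h ψ)
        rwa [hcol, ← hx] at this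
      · have := (funVCat T X).hom_refl x₀
        rwa [hx, ← hcol] at this
    intro x; rw [this]; rfl
  · intro hx
    rwa [show x₀ = finColim T h ψ from val_ext hx]

variable (T) in
/-- A map into a function space is finitely cocontinuous if it is `[0,1]`-functorial and
preserves the pointwise colimits. -/
theorem funVCat_finCocontinuous {Y : Type v} [TopologicalSpace Y] [PartialOrder Y]
    (f : (Y →Co Iᵒᵈ) → X →Co Iᵒᵈ)
    (h1 : ∀ ψ ψ' c, (∀ y, T.tensor (val ψ y) c ≤ val ψ' y) →
      ∀ x, T.tensor (val (f ψ) x) c ≤ val (f ψ') x)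
    (h2 : ∀ (S : Type) (_ : Finite S) (h : S → Y →Co Iᵒᵈ) (ψ : S → I) (x : X),
      val (f (finColim T h ψ)) x = ⨆ z, T.tensor (val (f (h z)) x) (ψ z)) :
    (funVCat T Y).FinCocontinuous (funVCat T X) f := by
  refine ⟨fun ψ ψ' => le_iInf fun x => ?_, fun A h ψ hA _ _ x₀ hx => ?_⟩
  · refine (T.le_hom_iff _ _ _).2 (h1 ψ ψ' _ (fun y => (T.le_hom_iff _ _ _).1 ?_) x)
    exact iInf_le (fun y => T.hom (val ψ y) (val ψ' y)) y
  · refine (funVCat_isColimit_iff _ ψ _).2 fun x => ?_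
    have hx' := (funVCat_isColimit_iff h ψ x₀).1 hx
    rw [show x₀ = finColim T h ψ from val_ext hx', h2 _ hA]
    rfl

end FunctionSpace

variable (T) in
/-- The object `C X`: all continuous monotone maps `X → [0,1]ᵒᵖ` with all operations defined
pointwise. -/
abbrev cOb (X : PosComp.{u}) : OminusMonoid.{u} T where
  toVCat := funVCat T X
  separated := funVCat_sep
  finCocomplete _ h ψ _ _ _ := ⟨finColim T h ψ, (funVCat_isColimit_iff h ψ _).2 fun _ => rfl⟩
  mul ψ ψ' := mkC (fun x => T.tensor (val ψ x) (val ψ' x))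
    (T.continuous_tensor.comp ((continuous_val ψ).prodMk (continuous_val ψ')))
    (tensor_antitone (antitone_val ψ) (antitone_val ψ'))
  one := mkC (fun _ => 1) continuous_const antitone_const
  mul_assoc _ _ _ := val_ext fun _ => T.assoc _ _ _
  mul_comm _ _ := val_ext fun _ => T.comm _ _
  mul_one _ := val_ext fun _ => T.tensor_one _
  le_one ψ := (funVCat_le_iff _ _).2 fun x => (val ψ x).2.2
  mul_finCocontinuous χ := by
    refine funVCat_finCocontinuous T _ (fun ψ ψ' c h x => ?_) fun S _ h ψ x => ?_
    · simp only [val_mkC, T.assoc]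
      exact T.tensor_mono_right _ (h x)
    · simp only [finColim, val_mkC, T.tensor_iSup, T.assoc]
  minus ψ u := mkC (fun x => tminus (val ψ x) u) ((continuous_tminus u).comp (continuous_val ψ))
    (tminus_antitone u (antitone_val ψ))
  minus_zero _ := val_ext fun _ => tminus_zero _
  minus_minus _ _ _ := val_ext fun _ => tminus_tminus _ _ _

variable (T) in
/-- Precomposition with `f`. -/
def pullback {X Y : PosComp.{u}} (f : X ⟶ Y) : StrictHom (cOb T Y) (cOb T X) where
  toFun ψ := ContinuousOrderHom.comp ψ f
  finCocontinuous := by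
    refine funVCat_finCocontinuous T _ (fun ψ ψ' c h x => h _) fun S _ h ψ x => rfl
  map_mul _ _ := rfl
  map_one := rfl
  map_minus _ _ := rfl

variable (T) in
/-- The functor `C` into monoids and strict homomorphisms. -/
def cStrict : PosComp.{u} ⥤ (Mnd.{u} T)ᵒᵖ where
  obj X := op ⟨cOb T X⟩
  map f := Quiver.Hom.op (V := Mnd T) (pullback T f)
  map_id _ := rfl
  map_comp _ _ := rfl

variable (T) in
/-- The functor `C` into monoids and lax homomorphisms. -/
def cLax : PosComp.{u} ⥤ (LaxMnd.{u} T)ᵒᵖ := cStrict T ⋙ (toLax T).op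

/-! ### The extension of `C` to continuous distributors -/

section SupOver

variable {X : Type u} [TopologicalSpace X] [PartialOrder X]

/-- The supremum of `ψ` over `A` (it is `0` if `A` is empty). -/
def supOver (A : ClosedUpper X) (ψ : X →Co Iᵒᵈ) : I := ⨆ x ∈ A.carrier, val ψ x

theorem supOver_antitone {A B : ClosedUpper X} (h : A ≤ B) (ψ : X →Co Iᵒᵈ) :
    supOver B ψ ≤ supOver A ψ := biSup_mono h

theorem tminus_supOver (A : ClosedUpper X) (ψ : X →Co Iᵒᵈ) (u : I) :
    tminus (supOver A ψ) u = ⨆ x ∈ A.carrier, tminus (val ψ x) u := by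
  have key : ∀ a c : I, tminus a u ≤ c ↔ a ≤ tplus c u := by
    intro a c
    have := a.2.1; have := a.2.2; have := c.2.1; have := c.2.2; have := u.2.1
    have := u.2.2
    rw [← Subtype.coe_le_coe, ← Subtype.coe_le_coe]
    simp only [tminus, tplus]
    grind
  refine eq_of_forall_ge_iff fun c => ?_
  simp only [supOver, key, iSup_le_iff]

theorem continuous_supOver [CompactSpace X] (ψ : X →Co Iᵒᵈ) :
    Continuous fun A : ClosedUpper X => supOver A ψ := by
  refine OrderTopology.continuous_iff.2 fun c => ⟨?_, ?_⟩
  · have : (fun A : ClosedUpper X => supOver A ψ) ⁻¹' Set.Ioi c = hit {x | c < val ψ x} := by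
      ext A
      simp only [Set.mem_preimage, Set.mem_Ioi, supOver, lt_iSup_iff, hit, Set.mem_ofPred_eq,
        exists_prop]
      rfl
    rw [this]
    exact isOpen_hit (isOpen_lt continuous_const (continuous_val ψ))
      fun _ _ h hc => lt_of_lt_of_le hc (antitone_val ψ h)
  · by_cases hc : c = 0
    · convert isOpen_empty
      ext A
      simp only [hc, Set.mem_preimage, Set.mem_Iio, Set.mem_empty_iff_false, iff_false, not_lt]
      exact unitInterval.nonneg'
    · have hc' : 0 < c := unitInterval.pos_iff_ne_zero.2 hc
      have : (fun A : ClosedUpper X => supOver A ψ) ⁻¹' Set.Iio c = miss {x | c ≤ val ψ x} := by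
        ext A
        simp only [Set.mem_preimage, Set.mem_Iio, miss, Set.mem_ofPred_eq,
          Set.eq_empty_iff_forall_notMem, Set.mem_inter_iff, not_and, not_le]
        constructor
        · exact fun h x hx => lt_of_le_of_lt (le_biSup (val ψ) hx) h
        · intro h
          rcases A.carrier.eq_empty_or_nonempty with hA | hA
          · have : supOver A ψ = 0 := by
              simp only [supOver, hA, Set.mem_empty_iff_false, iSup_false, iSup_bot]
              rfl
            rwa [this]
          · obtain ⟨x, hx, hmax⟩ :=
              A.isClosed.isCompact.exists_isMaxOn hA (continuous_val ψ).continuousOn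
            exact lt_of_le_of_lt (iSup₂_le fun y hy => hmax hy) (h x hx)
      rw [this]
      exact isOpen_miss (isClosed_le continuous_const (continuous_val ψ))
        fun _ _ h hc => le_trans (α := I) hc (antitone_val ψ h)

end SupOver

theorem supAlong_antitone {X Y : PosComp.{u}} (φ : X ⟶ vietoris.obj Y) (ψ : Y →Co Iᵒᵈ) :
    Antitone fun x => supOver (X := Y) (PosComp.fn φ x) ψ :=
  fun _ _ h => supOver_antitone ((PosComp.fn φ).monotone' h) ψ

/-- `ψ ↦ (x ↦ sup {ψ y | x φ y})` for a continuous distributor `φ`. -/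
def supAlong {X Y : PosComp.{u}} (φ : X ⟶ vietoris.obj Y) (ψ : Y →Co Iᵒᵈ) : X →Co Iᵒᵈ :=
  mkC (fun x => supOver (X := Y) (PosComp.fn φ x) ψ)
    ((continuous_supOver ψ).comp (PosComp.fn φ).continuous_toFun)
    (supAlong_antitone φ ψ)

variable (T) in
/-- `C φ` as a lax homomorphism. -/
def supAlongHom {X Y : PosComp.{u}} (φ : X ⟶ vietoris.obj Y) :
    LaxHom (cOb T Y) (cOb T X) where
  toFun := supAlong φ
  finCocontinuous := by
    refine funVCat_finCocontinuous T _ (fun ψ ψ' c h x => ?_) fun S _ h ψ x => ?_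
    · simp only [supAlong, val_mkC, supOver, T.iSup_tensor]
      exact iSup₂_mono fun y _ => h y
    · simp only [supAlong, val_mkC, supOver, finColim, T.iSup_tensor]
      rw [iSup_comm]
      simp only [iSup_comm (ι := S)]
  map_mul_le ψ ψ' := by
    refine (funVCat_le_iff _ _).2 fun x => ?_
    refine iSup₂_le fun y hy => T.tensor_mono ?_ ?_
    · exact le_biSup (val ψ) hy
    · exact le_biSup (val ψ') hy
  map_minus ψ u := val_ext fun x => (tminus_supOver _ ψ u).symm

variable (T) in
/-- The functor `C` on continuous distributors. -/
def cDist : PosCompDist.{u} ⥤ (LaxMnd.{u} T)ᵒᵖ where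
  obj X := op ⟨cOb T X.of⟩
  map φ := Quiver.Hom.op (V := LaxMnd T) (supAlongHom T φ.of)
  map_id X := by
    refine Quiver.Hom.unop_inj (LaxHom.ext (funext fun ψ => val_ext fun x => ?_))
    refine le_antisymm (iSup₂_le fun y hy => antitone_val ψ hy) ?_
    exact le_biSup (val ψ) (show x ∈ Set.Ici x from le_rfl)
  map_comp {X Y Z} φ γ := by
    refine Quiver.Hom.unop_inj (LaxHom.ext (funext fun ψ => val_ext fun x => ?_))
    refine le_antisymm (iSup₂_le fun z hz => ?_) (iSup₂_le fun y hy => iSup₂_le fun z hz => ?_)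
    · obtain ⟨y, hy, hyz⟩ := (PosCompDist.rel_comp φ γ x z).1 hz
      exact (le_biSup (val ψ) hyz).trans (le_biSup (val (supAlong γ.of ψ)) hy)
    · exact le_biSup (val ψ) ((PosCompDist.rel_comp φ γ x z).2 ⟨y, hy, hz⟩)

/-! ### The functor `G` -/

section Spectrum

variable (A : OminusMonoid.{u} T)

/-- The underlying set of `G A`: the lax homomorphisms `A → [0,1]`. -/
abbrev Spec : Type u := LaxHom A (unitOb T)

variable {A}

/-- The value of `Φ` at `a`. -/
def Spec.eval (a : A.carrier) (Φ : Spec A) : I := Φ.toFun a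

/-- The order is initial for the evaluation maps into `[0,1]ᵒᵖ`. -/
instance : PartialOrder (Spec A) where
  le Φ Φ' := ∀ a, Spec.eval a Φ' ≤ Spec.eval a Φ
  le_refl _ _ := le_rfl
  le_trans _ _ _ h h' a := (h' a).trans (h a)
  le_antisymm _ _ h h' := LaxHom.ext (funext fun a => le_antisymm (h' a) (h a))

/-- The initial topology with respect to all evaluation maps into `[0,1]ᵒᵖ`. -/
instance : TopologicalSpace (Spec A) :=
  ⨅ a, TopologicalSpace.induced (fun Φ => OrderDual.toDual (Spec.eval a Φ)) inferInstance

theorem Spec.isInducing : Topology.IsInducing fun (Φ : Spec A) (a : A.carrier) =>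
    Spec.eval a Φ := by
  refine ⟨?_⟩
  simp only [Pi.topologicalSpace, induced_iInf, induced_compose]
  rfl

theorem Spec.continuous_eval (a : A.carrier) : Continuous (Spec.eval a : Spec A → I) :=
  (continuous_apply a).comp Spec.isInducing.continuous

theorem Spec.isClosed_range : IsClosed (Set.range fun (Φ : Spec A) (a : A.carrier) =>
    Spec.eval a Φ) := by
  have hev : ∀ a : A.carrier, Continuous fun f : A.carrier → I => f a := continuous_apply
  have h1 : IsClosed {f : A.carrier → I | ∀ x y, T.tensor (f x) (A.hom x y) ≤ f y} := by
    simp only [Set.ofPred_forall]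
    exact isClosed_iInter fun x => isClosed_iInter fun y =>
      isClosed_le (T.continuous_tensor.comp ((hev x).prodMk continuous_const)) (hev y)
  have h2 : IsClosed {f : A.carrier → I | ∀ (D : VCat.{0} T) (h : D.carrier → A.carrier)
      (ψ : D.carrier → I), Finite D.carrier → D.IsFunctor A.toVCat h → D.IsWeight ψ →
        ∀ x₀, A.toVCat.IsColimit h ψ x₀ → f x₀ = ⨆ z, T.tensor (f (h z)) (ψ z)} := by
    simp only [Set.ofPred_forall]
    refine isClosed_iInter fun D => isClosed_iInter fun h => isClosed_iInter fun ψ =>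
      isClosed_iInter fun hD => isClosed_iInter fun _ => isClosed_iInter fun _ =>
      isClosed_iInter fun x₀ => isClosed_iInter fun _ => ?_
    exact isClosed_eq (hev x₀) (continuous_iSup_finite fun z =>
      T.continuous_tensor.comp ((hev (h z)).prodMk continuous_const))
  have h3 : IsClosed {f : A.carrier → I | ∀ x y, f (A.mul x y) ≤ T.tensor (f x) (f y)} := by
    simp only [Set.ofPred_forall]
    exact isClosed_iInter fun x => isClosed_iInter fun y =>
      isClosed_le (hev _) (T.continuous_tensor.comp ((hev x).prodMk (hev y)))
  have h4 : IsClosed {f : A.carrier → I | ∀ x u, f (A.minus x u) = tminus (f x) u} := by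
    simp only [Set.ofPred_forall]
    exact isClosed_iInter fun x => isClosed_iInter fun u =>
      isClosed_eq (hev _) ((continuous_tminus u).comp (hev x))
  convert h1.inter (h2.inter (h3.inter h4)) using 1
  ext f
  constructor
  · rintro ⟨Φ, rfl⟩
    refine ⟨fun x y => ?_, fun D h ψ hD hh hψ x₀ hx => ?_, fun x y => ?_, fun x u => ?_⟩
    · exact (T.le_hom_iff _ _ _).1 (Φ.finCocontinuous.1 x y)
    · exact (unitVCat_isColimit_iff _ ψ _).1 (Φ.finCocontinuous.2 D h ψ hD hh hψ x₀ hx)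
    · exact (T.one_le_hom_iff _ _).1 (Φ.map_mul_le x y)
    · exact Φ.map_minus x u
  · rintro ⟨g1, g2, g3, g4⟩
    refine ⟨⟨f, ⟨fun x y => (T.le_hom_iff _ _ _).2 (g1 x y), fun D h ψ hD hh hψ x₀ hx => ?_⟩,
      fun x y => (T.one_le_hom_iff _ _).2 (g3 x y), g4⟩, rfl⟩
    exact (unitVCat_isColimit_iff _ ψ _).2 (g2 D h ψ hD hh hψ x₀ hx)

instance : CompactSpace (Spec A) := by
  refine isCompact_univ_iff.1 (Spec.isInducing.isCompact_iff.2 ?_)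
  rw [Set.image_univ]
  exact Spec.isClosed_range.isCompact

instance : OrderClosedTopology (Spec A) := by
  refine ⟨?_⟩
  rw [show {p : Spec A × Spec A | p.1 ≤ p.2} =
    ⋂ a, {p | Spec.eval a p.2 ≤ Spec.eval a p.1} by ext; simp; rfl]
  exact isClosed_iInter fun a => isClosed_le ((Spec.continuous_eval a).comp continuous_snd)
    ((Spec.continuous_eval a).comp continuous_fst)

end Spectrum

variable (T) in
/-- The functor `G`, given on morphisms by precomposition. -/
def gFunctor : (LaxMnd.{u} T)ᵒᵖ ⥤ PosComp.{u} where
  obj A := { carrier := Spec A.unop.ob }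
  map {A B} f :=
    { toFun := fun Φ : Spec A.unop.ob => (Φ.comp f.unop : Spec B.unop.ob)
      monotone' := fun _ _ h b => h (f.unop.toFun b)
      continuous_toFun := Spec.isInducing.continuous_iff.2
        (continuous_pi fun b => Spec.continuous_eval (f.unop.toFun b)) }
  map_id _ := rfl
  map_comp _ _ := rfl

end EnrichedDuality

end

open EnrichedDuality

noncomputable section

namespace EnrichedDuality

variable {T : ContTNorm}

/-! ### Monotone separation in partially ordered compact spaces -/

/-! The heart of the matter is a representation theorem: every lax homomorphism `Φ : CX → [0,1]` is
the supremum over exactly one closed upper set. Uniqueness is Nachbin's separation theorem, obtained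
by running Urysohn's construction with open upper sets (`exists_val_eq_zero_one`,
`closedUpper_le_iff`).

For existence, take the common zero set `A` of the kernel of `Φ`. Since `Φ` preserves `⊖`, the
function `ψ ⊖ Φ(ψ)` lies in the kernel and so vanishes on `A`, which gives `sup_A ψ ≤ Φ(ψ)`.
Likewise `ψ ⊖ sup_A ψ` vanishes on `A`, so the other inequality reduces to showing that `Φ` kills
every `ψ` vanishing on `A` (`Spec.eval_eq_zero_of_vanish`). By compactness some `χ` in the kernel is
bounded below by a `δ > 0` on `{ψ ≥ ε}`. The supremum `a` of the values of `Φ` on functions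
supported slightly inside that set satisfies `a ⊗ δ = 0` by comparison with `χ`. The t-norm may have
zero divisors, so this alone does not give `a = 0`; but lax multiplicativity makes `a` idempotent,
and for a continuous t-norm an idempotent `a` fixes everything below it, which forces `a = 0`.

The rest is largely formal. The adjunction is evaluation on both sides, and `j` is a continuous
order isomorphism from a compact to a Hausdorff space. On distributors, `C φ` is the transpose of
`φ` followed by `j`, so `C` is a bijection on hom-sets. For strict homomorphisms, preservation of
`⊗` and the unit makes each representing closed upper set principal (`exists_eq_upc`), so the
distributor is a map. -/

/-- If all the open sets `U` in Urysohn's construction are upper, the initial approximations are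
indicators of lower sets, hence antitone; midpoints and suprema keep this. -/
theorem urysohn_lim_antitone {X : Type u} [TopologicalSpace X] [PartialOrder X]
    (c : Urysohns.CU (X := X) fun _ U => IsUpperSet U) : Antitone c.lim := by
  have approx : ∀ (n : ℕ) (c : Urysohns.CU (X := X) fun _ U => IsUpperSet U),
      Antitone (c.approx n) := by
    intro n
    induction n with
    | zero =>
      intro c x y hxy
      by_cases hy : y ∈ c.U
      · simp only [Urysohns.CU.approx]
        rw [Set.indicator_of_notMem (by simpa using hy)]
        exact Set.indicator_nonneg (fun _ _ => zero_le_one) _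
      · have hx : x ∉ c.U := fun hx => hy (c.P_C_U hxy hx)
        rw [c.approx_of_notMem_U _ hx, c.approx_of_notMem_U _ hy]
    | succ n ih =>
      intro c x y hxy
      exact midpoint_le_midpoint (ih c.left hxy) (ih c.right hxy)
  exact fun x y hxy => ciSup_mono (c.bddAbove_range_approx x) fun n => approx n c hxy

section Separation

variable {X : Type u} [TopologicalSpace X] [PartialOrder X] [CompactSpace X]
  [OrderClosedTopology X]

/-- This is the interpolation step of Urysohn's construction within upper sets. `V` is the largest
upper set inside an open neighbourhood of the upper closure of `c`; it is open because down-closures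
of closed sets are closed. -/
theorem exists_isOpen_upper_closure_subset {c U : Set X} (hc : IsClosed c) (hU : IsOpen U)
    (hU' : IsUpperSet U) (h : c ⊆ U) :
    ∃ V, IsOpen V ∧ IsUpperSet V ∧ c ⊆ V ∧ closure V ⊆ U := by
  have hdisj : Disjoint {y | ∃ x ∈ c, x ≤ y} Uᶜ :=
    Set.disjoint_left.2 fun y ⟨x, hx, hxy⟩ hy => hy (hU' hxy (h hx))
  obtain ⟨O₁, O₂, hO₁, hO₂, hcO, hUO, hO⟩ :=
    SeparatedNhds.of_isCompact_isCompact (isClosed_up hc).isCompact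
      hU.isClosed_compl.isCompact hdisj
  refine ⟨{y | ∃ z ∈ O₁ᶜ, y ≤ z}ᶜ, (isClosed_down hO₁.isClosed_compl).isOpen_compl,
    fun a b hab ha ⟨z, hz, hbz⟩ => ha ⟨z, hz, hab.trans hbz⟩,
    fun x hx ⟨z, hz, hxz⟩ => hz (hcO ⟨x, hx, hxz⟩), ?_⟩
  have h1 : {y | ∃ z ∈ O₁ᶜ, y ≤ z}ᶜ ⊆ O₂ᶜ := fun y hy hy₂ =>
    hy ⟨y, fun hy₁ => Set.disjoint_left.1 hO hy₁ hy₂, le_rfl⟩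
  refine (closure_minimal h1 hO₂.isClosed_compl).trans fun y hy => ?_
  by_contra hyU
  exact hy (hUO hyU)

/-- Nachbin's separation theorem: a closed upper set is separated from every point outside by a
continuous antitone map into the unit interval. -/
theorem exists_val_eq_zero_one (A : ClosedUpper X) {x : X} (hx : x ∉ A.carrier) :
    ∃ ψ : X →Co Iᵒᵈ, (∀ y ∈ A.carrier, val ψ y = 0) ∧ val ψ x = 1 := by
  let c : Urysohns.CU (X := X) fun _ U => IsUpperSet U :=
    { C := A.carrier
      -- The largest upper set that avoids `x`.
      U := (Set.Iic x)ᶜ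
      P_C_U := (isLowerSet_Iic x).compl
      closed_C := A.isClosed
      open_U := isClosed_Iic.isOpen_compl
      subset := fun y hy hyx => hx (A.isUpper hyx hy)
      hP := fun hc hU' hU h => by
        obtain ⟨V, hV, hV', hcV, hVU⟩ := exists_isOpen_upper_closure_subset hc hU hU' h
        exact ⟨V, hV, hcV, hVU, hV', hU'⟩ }
  refine ⟨mkC (fun y => ⟨c.lim y, c.lim_mem_Icc y⟩) (c.continuous_lim.subtype_mk _)
    fun y z h => urysohn_lim_antitone c h, fun y hy => ?_, ?_⟩
  · exact Subtype.ext (c.lim_of_mem_C y hy)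
  · exact Subtype.ext (c.lim_of_notMem_U x fun h => h le_rfl)

theorem exists_val_eq_zero_one_of_not_le {x y : X} (h : ¬ x ≤ y) :
    ∃ ψ : X →Co Iᵒᵈ, val ψ x = 0 ∧ val ψ y = 1 := by
  obtain ⟨ψ, h0, h1⟩ := exists_val_eq_zero_one (upc x) (x := y) h
  exact ⟨ψ, h0 x le_rfl, h1⟩

/-- A point of `B` outside `A` is detected by a function that is `0` on `A` and `1` there. Hence
taking suprema is an order embedding. -/
theorem closedUpper_le_iff (A B : ClosedUpper X) :
    A ≤ B ↔ ∀ ψ, supOver B ψ ≤ supOver A ψ := by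
  refine ⟨supOver_antitone, fun h x hx => ?_⟩
  by_contra hxA
  obtain ⟨ψ, h0, h1⟩ := exists_val_eq_zero_one A hxA
  have hA : supOver A ψ ≤ 0 := iSup₂_le fun y hy => (h0 y hy).le
  have hB : 1 ≤ supOver B ψ := h1 ▸ le_biSup (val ψ) hx
  exact absurd ((hB.trans (h ψ)).trans hA) (not_le.2 zero_lt_one)

end Separation

/-! ### Continuous t-norms -/

namespace ContTNorm

variable (T)

theorem tensor_zero (u : I) : T.tensor u 0 = 0 :=
  le_antisymm ((T.tensor_mono (v := 0) u.2.2 le_rfl).trans_eq (T.one_tensor 0)) bot_le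

theorem tensor_le_left (u v : I) : T.tensor u v ≤ u :=
  (T.tensor_mono_right u v.2.2).trans_eq (T.tensor_one u)

theorem tensor_le_right (u v : I) : T.tensor u v ≤ v := T.comm u v ▸ T.tensor_le_left v u

variable {T}

/-- By the intermediate value theorem `a ⊗ -` takes every value from `0` to `a`, so `u = a ⊗ v` and
idempotence absorbs the second `a`. -/
theorem tensor_eq_right_of_idempotent {a u : I} (ha : T.tensor a a = a) (hu : u ≤ a) :
    T.tensor a u = u := by
  obtain ⟨v, hv⟩ : u ∈ Set.range (T.tensor a) := by
    refine mem_range_of_exists_le_of_exists_ge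
      (T.continuous_tensor.comp (continuous_const.prodMk continuous_id)) ⟨0, ?_⟩ ⟨1, ?_⟩
    · exact (T.tensor_zero a).trans_le bot_le
    · exact hu.trans_eq (T.tensor_one a).symm
  rw [← hv, ← T.assoc, ha]

/-- The hypothesis makes `a` idempotent. If `δ ≤ a`, then `a ⊗ δ = δ > 0`, a contradiction;
otherwise `a ≤ a ⊗ a ≤ a ⊗ δ = 0`. -/
theorem eq_zero_of_le_tensor_self {a δ : I} (ha : a ≤ T.tensor a a) (hδ : 0 < δ)
    (h : T.tensor a δ = 0) : a = 0 := by
  have ha' := le_antisymm (T.tensor_le_left a a) ha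
  rcases le_total δ a with hle | hle
  · rw [tensor_eq_right_of_idempotent ha' hle] at h
    exact absurd h hδ.ne'
  · exact le_antisymm ((ha.trans (T.tensor_mono_right a hle)).trans_eq h) bot_le

end ContTNorm

theorem tminus_self (u : I) : tminus u u = 0 := Subtype.ext (by simp [tminus])

theorem tminus_eq_zero_iff {u v : I} : tminus u v = 0 ↔ u ≤ v := by
  rw [← Subtype.coe_le_coe, ← Subtype.coe_inj]
  simp [tminus]

/-! ### Lax homomorphisms into the unit interval are suprema over closed upper sets -/

variable (T) in
/-- The discrete `[0,1]`-category. -/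
def discreteVCat (S : Type) : VCat.{0} T where
  carrier := S
  hom x y := ⨆ _ : x = y, 1
  hom_refl x := by simp
  hom_trans x y z := by
    by_cases hxy : x = y
    · subst hxy; exact T.tensor_le_right _ _
    · have : (⨆ _ : x = y, (1 : I)) = 0 := by simp only [hxy, iSup_false]; rfl
      rw [this, T.comm, T.tensor_zero]; exact bot_le

/-- Off the diagonal the homs are the empty supremum `0`, so no compatibility is required: arbitrary
finite families and weights become admissible diagrams. -/
theorem discreteVCat_isFunctor {S : Type} {X : VCat.{u} T} (h : S → X.carrier) :
    (discreteVCat T S).IsFunctor X h := fun x y => by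
  refine iSup_le fun hxy => ?_
  subst hxy; exact X.hom_refl _

theorem discreteVCat_isWeight {S : Type} (ψ : S → I) : (discreteVCat T S).IsWeight ψ := by
  intro x y
  by_cases hxy : x = y
  · subst hxy; exact T.tensor_le_right _ _
  · have : IsEmpty (x = y) := ⟨hxy⟩
    rw [show (discreteVCat T S).hom x y = 0 from @iSup_of_empty _ _ _ this _, T.comm, T.tensor_zero]; exact bot_le

theorem exists_continuous_monotone_step {a b : I} (hab : a < b) :
    ∃ f : I → I, Continuous f ∧ Monotone f ∧ (∀ t ≤ a, f t = 0) ∧ ∀ t, b ≤ t → f t = 1 := by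
  have hab' : (0 : ℝ) < b - a := sub_pos.2 hab
  refine ⟨fun t => Set.projIcc 0 1 zero_le_one (((t : ℝ) - a) / (b - a)),
    continuous_projIcc.comp (by fun_prop), fun s t hst => Set.monotone_projIcc _ ?_,
    fun t ht => Set.projIcc_of_le_left _ ?_, fun t ht => Set.projIcc_of_right_le _ ?_⟩
  · have : (s : ℝ) ≤ t := hst
    gcongr
  · have : (t : ℝ) ≤ a := ht
    exact div_nonpos_of_nonpos_of_nonneg (by linarith) hab'.le
  · have : (b : ℝ) ≤ t := ht
    rw [le_div_iff₀ hab']; linarith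

namespace Spec

variable {X : PosComp.{u}} (Φ : Spec (cOb T X))

theorem eval_finColim {S : Type} [Finite S] (h : S → X →Co Iᵒᵈ) (ψ : S → I) :
    eval (A := cOb T X) (finColim T h ψ) Φ = ⨆ z, T.tensor (eval (A := cOb T X) (h z) Φ) (ψ z) :=
  (unitVCat_isColimit_iff _ ψ _).1
    (Φ.finCocontinuous.2 (discreteVCat T S) h ψ ‹_› (discreteVCat_isFunctor (X := funVCat T X) h)
      (discreteVCat_isWeight ψ) _ ((funVCat_isColimit_iff h ψ _).2 fun _ => rfl))

theorem eval_tensor_le {ψ ψ' : X →Co Iᵒᵈ} {c : I} (h : ∀ x, T.tensor (val ψ x) c ≤ val ψ' x) :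
    T.tensor (eval (A := cOb T X) ψ Φ) c ≤ eval (A := cOb T X) ψ' Φ :=
  (T.le_hom_iff _ _ _).1 ((le_iInf fun x => (T.le_hom_iff _ _ _).2 (h x)).trans
    (Φ.finCocontinuous.1 ψ ψ'))

theorem eval_mono {ψ ψ' : X →Co Iᵒᵈ} (h : ∀ x, val ψ x ≤ val ψ' x) :
    eval (A := cOb T X) ψ Φ ≤ eval (A := cOb T X) ψ' Φ := by
  rw [← T.tensor_one (eval (A := cOb T X) ψ Φ)]
  exact Φ.eval_tensor_le fun x => (T.tensor_one _).trans_le (h x)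

/-- The zero function is the colimit of the empty diagram, which `Φ` preserves. -/
theorem eval_eq_zero {ψ : X →Co Iᵒᵈ} (h : ∀ x, val ψ x = 0) :
    eval (A := cOb T X) ψ Φ = 0 := by
  have h0 : eval (A := cOb T X) (finColim T (S := Empty) Empty.elim Empty.elim) Φ = 0 :=
    (Φ.eval_finColim _ _).trans (iSup_of_empty _)
  exact le_antisymm ((Φ.eval_mono fun x => (h x).trans_le bot_le).trans_eq h0) bot_le

theorem exists_eval_eq_sup (χ χ' : X →Co Iᵒᵈ) : ∃ ω : X →Co Iᵒᵈ,
    (∀ x, val ω x = val χ x ⊔ val χ' x) ∧ eval (A := cOb T X) ω Φ =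
      eval (A := cOb T X) χ Φ ⊔ eval (A := cOb T X) χ' Φ := by
  refine ⟨finColim T (fun b : Bool => bif b then χ else χ') fun _ => 1, fun x => ?_, ?_⟩
  · simp [finColim, iSup_bool_eq, T.tensor_one]
  · simp [eval_finColim, iSup_bool_eq, T.tensor_one]

/-- The points at which every function that `Φ` sends to `0` vanishes. -/
def zeroLocus : ClosedUpper X where
  carrier := {x | ∀ ψ : X →Co Iᵒᵈ, eval (A := cOb T X) ψ Φ = 0 → val ψ x = 0}
  isClosed := by
    simp only [Set.ofPred_forall]
    exact isClosed_iInter fun ψ => isClosed_iInter fun _ =>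
      isClosed_eq (continuous_val ψ) continuous_const
  isUpper := fun x y hxy hx ψ hψ =>
    le_antisymm ((antitone_val ψ hxy).trans_eq (hx ψ hψ)) bot_le

/-- Near each point of `K` some kernel element is bounded away from `0`. Compactness leaves finitely
many, and their join stays in the kernel because `Φ` preserves binary suprema. -/
theorem exists_pos_le_of_disjoint_zeroLocus {K : Set X} (hK : IsClosed K)
    (h : ∀ x ∈ K, x ∉ Φ.zeroLocus.carrier) :
    ∃ (χ : X →Co Iᵒᵈ) (δ : I), eval (A := cOb T X) χ Φ = 0 ∧ 0 < δ ∧ ∀ x ∈ K, δ ≤ val χ x := by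
  refine hK.isCompact.induction_on (p := fun s => ∃ (χ : X →Co Iᵒᵈ) (δ : I),
    eval (A := cOb T X) χ Φ = 0 ∧ 0 < δ ∧ ∀ x ∈ s, δ ≤ val χ x) ?_ ?_ ?_ ?_
  · exact ⟨mkC (fun _ => 0) continuous_const antitone_const, 1, Φ.eval_eq_zero fun _ => rfl,
      zero_lt_one, fun x hx => hx.elim⟩
  · rintro s t hst ⟨χ, δ, h1, h2, h3⟩
    exact ⟨χ, δ, h1, h2, fun x hx => h3 x (hst hx)⟩
  · rintro s t ⟨χ, δ, h1, h2, h3⟩ ⟨χ', δ', h1', h2', h3'⟩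
    obtain ⟨ω, hω, hΦ⟩ := Φ.exists_eval_eq_sup χ χ'
    refine ⟨ω, δ ⊓ δ', by rw [hΦ, h1, h1', sup_idem], lt_min h2 h2', ?_⟩
    rintro x (hx | hx)
    · exact inf_le_left.trans ((h3 x hx).trans (le_sup_left.trans_eq (hω x).symm))
    · exact inf_le_right.trans ((h3' x hx).trans (le_sup_right.trans_eq (hω x).symm))
  · intro x hx
    obtain ⟨χ, hχ, hχx⟩ : ∃ χ : X →Co Iᵒᵈ, eval (A := cOb T X) χ Φ = 0 ∧ val χ x ≠ 0 := by
      simpa [zeroLocus] using h x hx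
    obtain ⟨δ, hδ, hδx⟩ := exists_between (unitInterval.pos_iff_ne_zero.2 hχx)
    exact ⟨{y | δ < val χ y}, mem_nhdsWithin_of_mem_nhds
      ((isOpen_lt continuous_const (continuous_val χ)).mem_nhds hδx), χ, δ, hχ, hδ,
      fun y hy => le_of_lt hy⟩

/-- The core of the representation theorem: `small` treats functions supported strictly inside `{ψ >
ε}` by the idempotent argument, and `⊖` reduces `ψ` to such functions. -/
theorem eval_eq_zero_of_vanish {ψ : X →Co Iᵒᵈ} (h : ∀ x ∈ Φ.zeroLocus.carrier, val ψ x = 0) :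
    eval (A := cOb T X) ψ Φ = 0 := by
  have small : ∀ ε : I, 0 < ε → ∀ ρ : X →Co Iᵒᵈ,
      (∃ r, ε < r ∧ ∀ x, val ψ x ≤ r → val ρ x = 0) → eval (A := cOb T X) ρ Φ = 0 := by
    intro ε hε ρ hρ
    obtain ⟨χ, δ, hχ, hδ, hχδ⟩ := Φ.exists_pos_le_of_disjoint_zeroLocus
      (isClosed_le continuous_const (continuous_val ψ) : IsClosed {x : X | ε ≤ val ψ x})
      fun x hx hx' => absurd ((hx : ε ≤ _).trans_eq (h x hx')) (not_le.2 hε)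
    -- The strict margin `ε < r` leaves room for another cut-off in the same class, which is what
    -- makes `sSup S` idempotent.
    let S : Set I := {t | ∃ ρ : X →Co Iᵒᵈ, (∃ r, ε < r ∧ ∀ x, val ψ x ≤ r → val ρ x = 0) ∧
      eval (A := cOb T X) ρ Φ = t}
    have hS : sSup S ≤ T.tensor (sSup S) (sSup S) := by
      refine sSup_le ?_
      rintro _ ⟨ρ, ⟨r, hr, hρ⟩, rfl⟩
      -- The cut-off `ρ'` is `0` where `ψ ≤ q` and `1` where `ψ ≥ r`. Thus `ρ ≤ ρ ⊗ ρ'`, and `ρ'` is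
      -- again in the class, with threshold `q > ε`.
      obtain ⟨q, hq, hqr⟩ := exists_between hr
      obtain ⟨f, hf, hf', hf0, hf1⟩ := exists_continuous_monotone_step hqr
      let ρ' : X →Co Iᵒᵈ := mkC (fun x => f (val ψ x)) (hf.comp (continuous_val ψ))
        fun x y hxy => hf' (antitone_val ψ hxy)
      have h1 : eval (A := cOb T X) ρ Φ ≤ eval (A := cOb T X) ((cOb T X).mul ρ ρ') Φ := by
        refine Φ.eval_mono fun x => ?_
        rcases le_total (val ψ x) r with hx | hx
        · exact (hρ x hx).trans_le bot_le
        · have : val ρ' x = 1 := hf1 _ hx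
          exact (T.tensor_one _).symm.trans_le (T.tensor_mono_right _ this.ge)
      refine (h1.trans ((T.one_le_hom_iff _ _).1 (Φ.map_mul_le ρ ρ'))).trans (T.tensor_mono ?_ ?_)
      · exact le_sSup ⟨ρ, ⟨r, hr, hρ⟩, rfl⟩
      · exact le_sSup ⟨ρ', ⟨q, hq, fun x hx => hf0 _ hx⟩, rfl⟩
    -- Pointwise `ρ ⊗ δ ≤ χ`: either `ρ` vanishes, or `ψ ≥ r > ε` and there `δ ≤ χ`. Now use `Φ(χ) =
    -- 0`.
    have hδS : T.tensor (sSup S) δ = 0 := by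
      rw [T.comm, T.tensor_sSup]
      refine le_antisymm (sSup_le ?_) bot_le
      rintro _ ⟨_, ⟨ρ, ⟨r, hr, hρ⟩, rfl⟩, rfl⟩
      rw [T.comm]
      refine (Φ.eval_tensor_le fun x => ?_).trans_eq hχ
      rcases le_total (val ψ x) r with hx | hx
      · rw [hρ x hx, T.comm, T.tensor_zero]; exact bot_le
      · exact (T.tensor_le_right _ _).trans (hχδ x (hr.le.trans hx))
    have hρS : eval (A := cOb T X) ρ Φ ∈ S := ⟨ρ, hρ, rfl⟩
    exact le_antisymm ((le_sSup hρS).trans_eq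
      (ContTNorm.eq_zero_of_le_tensor_self hS hδ hδS)) bot_le
  -- For every `r > 0`, `ψ ⊖ r` vanishes where `ψ ≤ r`, so `small` applies with any `0 < ε < r` and
  -- gives `Φ(ψ) ⊖ r = 0`.
  refine le_antisymm (le_of_forall_gt_imp_ge_of_dense fun r hr => ?_) bot_le
  obtain ⟨ε, hε, hεr⟩ := exists_between hr
  rw [← tminus_eq_zero_iff]
  exact (Φ.map_minus ψ r).symm.trans
    (small ε hε ((cOb T X).minus ψ r) ⟨r, hεr, fun x hx => tminus_eq_zero_iff.2 hx⟩)

/-- Both inequalities `u ≤ v` are read as `u ⊖ v = 0`, and `⊖` is moved inside `Φ` or evaluated at a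
point. -/
theorem eval_eq_supOver (ψ : X →Co Iᵒᵈ) :
    eval (A := cOb T X) ψ Φ = supOver Φ.zeroLocus ψ := by
  refine le_antisymm ?_ (iSup₂_le fun x hx => ?_)
  · rw [← tminus_eq_zero_iff]
    refine (Φ.map_minus ψ _).symm.trans (Φ.eval_eq_zero_of_vanish fun x hx => ?_)
    exact tminus_eq_zero_iff.2 (le_biSup (val ψ) hx)
  · rw [← tminus_eq_zero_iff]
    exact hx ((cOb T X).minus ψ _) ((Φ.map_minus ψ _).trans (tminus_self _))

end Spec

/-! ### The adjunction -/

variable (T) in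
/-- Evaluation at a point as a lax homomorphism. -/
def evalAt (X : PosComp.{u}) (x : X) : Spec (cOb T X) where
  toFun ψ := val ψ x
  finCocontinuous := ⟨fun ψ ψ' => iInf_le (fun x => T.hom (val ψ x) (val ψ' x)) x,
    fun _ h ψ _ _ _ x₀ hx => (unitVCat_isColimit_iff _ ψ _).2
      ((funVCat_isColimit_iff h ψ x₀).1 hx x)⟩
  map_mul_le _ _ := (T.one_le_hom_iff _ _).2 le_rfl
  map_minus _ _ := rfl

variable (T) in
/-- The unit `x ↦ ev_x`. -/
def evalUnit (X : PosComp.{u}) : X ⟶ (gFunctor T).obj ((cLax T).obj X) where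
  toFun := evalAt T X
  monotone' := fun _ _ h ψ => antitone_val ψ h
  continuous_toFun := Spec.isInducing.continuous_iff.2 (continuous_pi fun ψ => continuous_val ψ)

/-- The counit `a ↦ ev_a`. -/
def evalCounit (A : OminusMonoid.{u} T) :
    LaxHom A (cOb T ((gFunctor T).obj (op ⟨A⟩))) where
  toFun a := mkC (X := Spec A) (Spec.eval a) (Spec.continuous_eval a) fun _ _ h => h a
  finCocontinuous := by
    refine ⟨fun a b => le_iInf fun Φ : Spec A => Φ.finCocontinuous.1 a b,
      fun D h ψ hD hh hψ x₀ hx => (funVCat_isColimit_iff _ ψ _).2 fun Φ : Spec A => ?_⟩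
    exact (unitVCat_isColimit_iff _ ψ _).1 (Φ.finCocontinuous.2 D h ψ hD hh hψ x₀ hx)
  map_mul_le a b := (funVCat_le_iff _ _).2 fun Φ : Spec A =>
    (T.one_le_hom_iff _ _).1 (Φ.map_mul_le a b)
  map_minus a u := val_ext fun Φ : Spec A => Φ.map_minus a u

variable (T) in
/-- The dual adjunction, whose unit and counit are given by evaluation. -/
def dualAdj : cLax.{u} T ⊣ gFunctor.{u} T where
  unit := { app := evalUnit T }
  counit :=
    { app A := Quiver.Hom.op (V := LaxMnd T) (evalCounit A.unop.ob)
      naturality _ _ _ := rfl }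
  left_triangle_components _ := rfl
  right_triangle_components _ := rfl

/-! ### The Vietoris monad is the induced monad -/

variable (T) in
/-- The supremum over a closed upper set as a lax homomorphism. -/
def supOverHom (X : PosComp.{u}) (A : ClosedUpper X) : Spec (cOb T X) where
  toFun := supOver A
  finCocontinuous := by
    refine ⟨fun ψ ψ' => (T.le_hom_iff _ _ _).2 ?_, fun _ h ψ _ _ _ x₀ hx =>
      (unitVCat_isColimit_iff _ ψ _).2 ?_⟩
    · simp only [supOver, T.iSup_tensor]
      refine iSup₂_mono fun x _ => (T.le_hom_iff _ _ _).1 ?_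
      exact iInf_le (fun x => T.hom (val ψ x) (val ψ' x)) x
    · have hx' := (funVCat_isColimit_iff h ψ x₀).1 hx
      simp only [supOver, hx', T.iSup_tensor, Function.comp]
      rw [iSup_comm]
      simp only [iSup_comm (ι := _ ∈ _)]
  map_mul_le ψ ψ' := (T.one_le_hom_iff _ _).2 <| iSup₂_le fun x hx =>
    T.tensor_mono (le_biSup (val ψ) hx) (le_biSup (val ψ') hx)
  map_minus ψ u := (tminus_supOver A ψ u).symm

theorem supOverHom_le_iff {X : PosComp.{u}} (A B : ClosedUpper X) :
    supOverHom T X A ≤ supOverHom T X B ↔ A ≤ B :=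
  (closedUpper_le_iff A B).symm

theorem supOverHom_zeroLocus {X : PosComp.{u}} (Φ : Spec (cOb T X)) :
    supOverHom T X Φ.zeroLocus = Φ :=
  LaxHom.ext (funext fun ψ => (Φ.eval_eq_supOver ψ).symm)

theorem zeroLocus_mono {X : PosComp.{u}} {Φ Φ' : Spec (cOb T X)} (h : Φ ≤ Φ') :
    Φ.zeroLocus ≤ Φ'.zeroLocus :=
  (supOverHom_le_iff (T := T) _ _).1 <| by rwa [supOverHom_zeroLocus, supOverHom_zeroLocus]

variable (T) in
theorem continuous_supOverHom (X : PosComp.{u}) : Continuous (supOverHom T X) :=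
  Spec.isInducing.continuous_iff.2 (continuous_pi fun ψ => continuous_supOver ψ)

variable (T) in
/-- Closed upper sets correspond to lax homomorphisms into the unit interval. -/
def supOverEquiv (X : PosComp.{u}) : ClosedUpper X ≃ₜ Spec (cOb T X) :=
  -- Compactness of the source and the Hausdorff property of the target give continuity of the zero
  -- locus for free.
  Continuous.homeoOfEquivCompactToT2 (f :=
    { toFun := supOverHom T X
      invFun := Spec.zeroLocus
      left_inv := fun A => by
        -- `A` and the zero locus of its supremum functional have the same suprema, hence coincide
        -- by separation.
        have h := supOverHom_zeroLocus (supOverHom T X A)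
        exact le_antisymm ((supOverHom_le_iff _ _).1 h.le) ((supOverHom_le_iff _ _).1 h.ge)
      right_inv := supOverHom_zeroLocus }) (continuous_supOverHom T X)

variable (T) in
/-- `supOverEquiv` as an isomorphism of partially ordered compact spaces. -/
def supOverIso (X : PosComp.{u}) :
    (vietoris.{u} : PosComp.{u} ⥤ PosComp.{u}).obj X ≅
      (gFunctor T).obj ((cLax T).obj X) where
  hom :=
    { toFun := supOverHom T X
      monotone' := fun _ _ h => (supOverHom_le_iff _ _).2 h
      continuous_toFun := continuous_supOverHom T X }
  inv :=
    { toFun := fun Φ : Spec (cOb T X) => Φ.zeroLocus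
      monotone' := fun _ _ h => zeroLocus_mono (X := X) h
      continuous_toFun := (supOverEquiv T X).symm.continuous }
  hom_inv_id := ContinuousOrderHom.ext fun A => (supOverEquiv T X).left_inv A
  inv_hom_id := ContinuousOrderHom.ext fun Φ => supOverHom_zeroLocus (T := T) (X := X) Φ

/-- Passing to the upper closure adds only points where the antitone `ψ` is no larger. -/
theorem supOver_upImage {X : Type u} {Y : Type v} [TopologicalSpace X] [PartialOrder X]
    [CompactSpace X] [OrderClosedTopology X] [TopologicalSpace Y] [PartialOrder Y]
    [CompactSpace Y] [OrderClosedTopology Y] (f : X →Co Y) (A : ClosedUpper X)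
    (ψ : Y →Co Iᵒᵈ) : supOver (upImage f A) ψ = ⨆ x ∈ A.carrier, val ψ (f x) := by
  refine le_antisymm (iSup₂_le ?_) (iSup₂_le fun x hx => ?_)
  · rintro y ⟨x, hx, hxy⟩
    exact (antitone_val ψ hxy).trans (le_biSup (fun x => val ψ (f x)) hx)
  · exact le_biSup (val ψ) (show f x ∈ (upImage f A).carrier from ⟨x, hx, le_rfl⟩)

theorem supOver_upc {X : Type u} [TopologicalSpace X] [PartialOrder X] [CompactSpace X]
    [OrderClosedTopology X] (x : X) (ψ : X →Co Iᵒᵈ) : supOver (upc x) ψ = val ψ x :=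
  le_antisymm (iSup₂_le fun _ hy => antitone_val ψ hy)
    (le_biSup (val ψ) (show x ∈ (upc x).carrier from le_rfl))

theorem supOver_bigUnion {X : Type u} [TopologicalSpace X] [PartialOrder X] [CompactSpace X]
    [OrderClosedTopology X] (𝒜 : ClosedUpper (ClosedUpper X)) (ψ : X →Co Iᵒᵈ) :
    supOver (bigUnion 𝒜) ψ = ⨆ A ∈ 𝒜.carrier, supOver A ψ := by
  refine le_antisymm (iSup₂_le ?_) (iSup₂_le fun A hA => iSup₂_le fun x hx => ?_)
  · rintro x ⟨A, hA, hx⟩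
    exact (le_biSup (val ψ) hx).trans (le_biSup (fun A => supOver A ψ) hA)
  · exact le_biSup (val ψ) (show x ∈ (bigUnion 𝒜).carrier from ⟨A, hA, hx⟩)

variable (T) in
/-- The monad morphism from the Vietoris monad to the monad induced by the adjunction. -/
def supOverMonadHom : vietoris.{u} ⟶ (dualAdj T).toMonad where
  app X := (supOverIso T X).hom
  naturality X _ f := ContinuousOrderHom.ext fun A : ClosedUpper X =>
    LaxHom.ext (funext fun ψ => supOver_upImage (PosComp.fn f) A ψ)
  app_η X := ContinuousOrderHom.ext fun x : X =>
    LaxHom.ext (funext fun ψ => supOver_upc x ψ)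
  -- Both sides are the iterated supremum of `ψ` over the members of `𝒜`; on the induced monad it
  -- arises by evaluating at the function `ev_ψ`.
  app_μ X := ContinuousOrderHom.ext fun 𝒜 : ClosedUpper (ClosedUpper X) =>
    LaxHom.ext (funext fun ψ : X →Co Iᵒᵈ => (supOver_bigUnion 𝒜 ψ).trans
      (supOver_upImage (PosComp.fn (supOverIso T X).hom) 𝒜
        ((evalCounit (cOb T X)).toFun ψ)).symm)

/-- The forgetful functor from monads to endofunctors reflects isomorphisms, so the components
suffice. -/
instance : IsIso (supOverMonadHom.{u} T) := by
  have : ∀ X, IsIso (((monadToFunctor _).map (supOverMonadHom.{u} T)).app X) := fun X =>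
    inferInstanceAs (IsIso (supOverIso T X).hom)
  have : IsIso ((monadToFunctor _).map (supOverMonadHom.{u} T)) := NatIso.isIso_of_isIso_app _
  exact isIso_of_reflects_iso _ (monadToFunctor _)

/-! ### Full faithfulness -/

/-- This factors the action of `C` on hom-sets as composition with an isomorphism followed by the
adjunction bijection, so full faithfulness is immediate. -/
theorem cDist_map_eq {X Y : PosCompDist.{u}} (φ : X ⟶ Y) :
    (cDist T).map φ = ((dualAdj T).homEquiv X.of ((cLax T).obj Y.of)).symm
      (φ.of ≫ (supOverIso T Y.of).hom) := rfl

instance : (cDist.{u} T).Full where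
  map_surjective {X Y} h := by
    let e := (dualAdj T).homEquiv X.of ((cLax T).obj Y.of)
    have key : (e h ≫ (supOverIso T Y.of).inv) ≫ (supOverIso T Y.of).hom = e h := by
      rw [Category.assoc, Iso.inv_hom_id, Category.comp_id]
    exact ⟨⟨e h ≫ (supOverIso T Y.of).inv⟩,
      (congrArg e.symm key).trans (e.symm_apply_apply h)⟩

instance : (cDist.{u} T).Faithful where
  map_injective {X Y} φ φ' h := by
    rw [cDist_map_eq, cDist_map_eq] at h
    exact Kleisli.hom_ext ((cancel_mono (supOverIso T Y.of).hom).1 (Equiv.injective _ h))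

variable (T) in
/-- Precomposition with `f` as a lax homomorphism. -/
def pullbackLax {X Y : PosComp.{u}} (f : X ⟶ Y) : LaxHom (cOb T Y) (cOb T X) :=
  ((cLax T).map f).unop

variable (T) in
theorem toKleisli_comp_cDist :
    Kleisli.Adjunction.toKleisli vietoris.{u} ⋙ cDist T = cLax T :=
  CategoryTheory.Functor.hext (fun _ => rfl) fun X Y f => by
    have h : supAlongHom T (f ≫ vietoris.η.app Y) = (pullbackLax T f) :=
      LaxHom.ext (funext fun ψ => val_ext fun x => supOver_upc (PosComp.fn f x) ψ)
    exact heq_of_eq (congrArg (Quiver.Hom.op (V := LaxMnd T)) h)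

/-- A closed upper set over which suprema preserve the tensor and the unit is principal. -/
theorem exists_eq_upc {X : PosComp.{u}} (A : ClosedUpper X)
    (hmul : ∀ ψ ψ', supOver A ((cOb T X).mul ψ ψ') = T.tensor (supOver A ψ) (supOver A ψ'))
    (hone : supOver A (cOb T X).one = 1) : ∃ y, A = upc y := by
  -- A supremum equal to `1` excludes `A = ∅`, where it would be `0`; compactness then provides a
  -- maximum.
  have attained : ∀ ψ : X →Co Iᵒᵈ, supOver A ψ = 1 → ∃ x ∈ A.carrier, val ψ x = 1 := by
    intro ψ hψ
    have hne : A.carrier.Nonempty := by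
      rw [Set.nonempty_iff_ne_empty]
      intro hA
      simp only [supOver, hA, Set.mem_empty_iff_false, iSup_false, iSup_bot] at hψ
      exact absurd hψ zero_ne_one
    obtain ⟨x, hx, hmax⟩ := A.isClosed.isCompact.exists_isMaxOn hne (continuous_val ψ).continuousOn
    exact ⟨x, hx, le_antisymm (val ψ x).2.2 (hψ.ge.trans (iSup₂_le fun y hy => hmax hy))⟩
  let ι := {ψ : X →Co Iᵒᵈ // supOver A ψ = 1}
  have : Nonempty ι := ⟨⟨_, hone⟩⟩
  -- The generator `y` is a point of `A` where all functions with supremum `1` over `A` equal `1`.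
  -- The sets are directed because `ψ ⊗ ψ'` has supremum `1 ⊗ 1 = 1` and lies below both factors.
  obtain ⟨y, hy⟩ : (⋂ ψ : ι, {x | x ∈ A.carrier ∧ val ψ.1 x = 1}).Nonempty := by
    have hclosed : ∀ ψ : ι, IsClosed {x | x ∈ A.carrier ∧ val ψ.1 x = 1} := fun ψ =>
      A.isClosed.inter (isClosed_eq (continuous_val ψ.1) continuous_const)
    refine IsCompact.nonempty_iInter_of_directed_nonempty_isCompact_isClosed _ (fun ψ ψ' => ?_)
      (fun ψ => attained ψ.1 ψ.2) (fun ψ => (hclosed ψ).isCompact) hclosed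
    refine ⟨⟨(cOb T X).mul ψ.1 ψ'.1, by rw [hmul, ψ.2, ψ'.2, T.tensor_one]⟩, ?_, ?_⟩
    · exact fun x hx => ⟨hx.1, le_antisymm (val ψ.1 x).2.2
        (hx.2.ge.trans (T.tensor_le_left _ _))⟩
    · exact fun x hx => ⟨hx.1, le_antisymm (val ψ'.1 x).2.2
        (hx.2.ge.trans (T.tensor_le_right _ _))⟩
  simp only [Set.mem_iInter] at hy
  refine ⟨y, le_antisymm (fun z hz => A.isUpper hz (hy ⟨_, hone⟩).1) fun z hz => ?_⟩
  -- A separating `ψ` with value `1` at `z ∈ A` has supremum `1`, so it must be `1` at `y`, where it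
  -- is `0`.
  by_contra hyz
  obtain ⟨ψ, h0, h1⟩ := exists_val_eq_zero_one_of_not_le hyz
  have hψ : supOver A ψ = 1 :=
    le_antisymm (supOver A ψ).2.2 (h1.ge.trans (le_biSup (val ψ) hz))
  exact zero_ne_one (h0.symm.trans (hy ⟨ψ, hψ⟩).2)

theorem isEmbedding_upc (X : Type u) [TopologicalSpace X] [PartialOrder X] [CompactSpace X]
    [OrderClosedTopology X] : Topology.IsEmbedding (upc : X → ClosedUpper X) :=
  (continuous_upc.isClosedEmbedding fun x y h => by
    have h' : Set.Ici x = Set.Ici y := congrArg ClosedUpper.carrier h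
    exact Set.Ici_injective h').isEmbedding

/-- Regarded as lax, the homomorphism comes from a distributor whose value at `x` represents
evaluation at `x`. That functional is strict, so the value is principal, and its generator depends
continuously on `x` because `upc` is an embedding. -/
instance : (cStrict.{u} T).Full where
  map_surjective {X Y} h := by
    let h' : StrictHom (cOb T Y) (cOb T X) := h.unop
    let l : LaxHom (cOb T Y) (cOb T X) := (toLax T).map (X := ⟨cOb T Y⟩) (Y := ⟨cOb T X⟩) h'
    obtain ⟨φ, hφ⟩ := (cDist T).map_surjective (X := .mk vietoris X) (Y := .mk vietoris Y)
      (Quiver.Hom.op (V := LaxMnd T) l)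
    let A : X → ClosedUpper Y := PosComp.fn φ.of
    have hA : ∀ x ψ, supOver (A x) ψ = val (h'.toFun ψ) x := fun x ψ =>
      congrArg (fun k : LaxHom (cOb T Y) (cOb T X) => val (k.toFun ψ) x)
        (congrArg Quiver.Hom.unop hφ)
    have hup : ∀ x, ∃ y, A x = upc y := fun x => by
      refine exists_eq_upc (T := T) (A x) (fun ψ ψ' => ?_) ?_
      · rw [hA, hA, hA, h'.map_mul]; rfl
      · rw [hA, h'.map_one]; rfl
    choose f hf using hup
    have hcont : Continuous f := (isEmbedding_upc Y).continuous_iff.2 <|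
      (PosComp.fn φ.of).continuous_toFun.congr hf
    have hmono : Monotone f := fun x x' hx => by
      have : A x ≤ A x' := (PosComp.fn φ.of).monotone' hx
      rw [hf, hf] at this
      exact this (le_refl (f x'))
    refine ⟨(⟨⟨f, hmono⟩, hcont⟩ : X →Co Y), Quiver.Hom.unop_inj (StrictHom.ext
      (funext fun ψ => val_ext fun x => ?_))⟩
    exact (supOver_upc (f x) ψ).symm.trans ((hf x) ▸ hA x ψ)

instance : (cStrict.{u} T).Faithful where
  map_injective {X Y} f g h := by
    have hfg : ∀ (ψ : Y →Co Iᵒᵈ) (x : X), val ψ (PosComp.fn f x) = val ψ (PosComp.fn g x) :=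
      fun ψ x => congrArg (fun k : StrictHom (cOb T Y) (cOb T X) => val (k.toFun ψ) x)
        (congrArg Quiver.Hom.unop h)
    have le : ∀ y y' : Y, (∀ ψ : Y →Co Iᵒᵈ, val ψ y = val ψ y') → y ≤ y' := by
      intro y y' hy
      by_contra hyy'
      obtain ⟨ψ, h0, h1⟩ := exists_val_eq_zero_one_of_not_le hyy'
      exact zero_ne_one (h0.symm.trans ((hy ψ).trans h1))
    exact ContinuousOrderHom.ext fun x =>
      le_antisymm (le _ _ fun ψ => hfg ψ x) (le _ _ fun ψ => (hfg ψ x).symm)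

end EnrichedDuality

end

theorem mainTheorem3 (T : ContTNorm) :
    (∃ adj : cLax.{u} T ⊣ gFunctor.{u} T,
      (∀ (X : PosComp.{u}) (x : X) (ψ : X →Co Iᵒᵈ),
        Spec.eval (A := cOb T X) ψ (PosComp.fn (adj.unit.app X) x) = val ψ x) ∧
      (∀ (A : LaxMnd.{u} T) (a : A.ob.carrier) (Φ : Spec A.ob),
        val (X := Spec A.ob) ((adj.counit.app (op A)).unop.toFun a) Φ = Spec.eval a Φ) ∧
      ∃ j : vietoris.{u} ⟶ adj.toMonad,
        (∀ (X : PosComp.{u}) (A : ClosedUpper X) (ψ : X →Co Iᵒᵈ),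
          Spec.eval (A := cOb T X) ψ (PosComp.fn (j.app X) A) = ⨆ x ∈ A.carrier, val ψ x) ∧
        (∀ {X Y : PosCompDist.{u}} (φ : X ⟶ Y),
          (cDist T).map φ =
            (cLax T).map (φ.of ≫ j.app Y.of) ≫ adj.counit.app ((cLax T).obj Y.of)) ∧
        IsIso j) ∧
    Kleisli.Adjunction.toKleisli vietoris.{u} ⋙ cDist T = cLax T ∧
    ((cDist.{u} T).Full ∧ (cDist.{u} T).Faithful) ∧
    ((cStrict.{u} T).Full ∧ (cStrict.{u} T).Faithful) :=
  ⟨⟨dualAdj T, fun _ _ _ => rfl, fun _ _ _ => rfl, supOverMonadHom T, fun _ _ _ => rfl,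
    fun _ => rfl, inferInstance⟩, toKleisli_comp_cDist T, ⟨inferInstance, inferInstance⟩,
    inferInstance, inferInstance⟩
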